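/- Let $\mathbb{T}=\mathbb{R}/\mathbb{Z}$ and $\mathbb{A}=\mathbb{T}\times\mathbb{R}$. A continuous foliation of $\mathbb{A}$ into graphs is a family $\mathcal{F}$ of leaves $\{(\theta,\eta_a(\theta)) : \theta\in\mathbb{T}\}$, $a\in\mathbb{R}$, such that $(\theta,a)\mapsto(\theta,\eta_a(\theta))$ is a homeomorphism of $\mathbb{A}$; the foliation is called Lipschitz if the parametrization $a\mapsto\eta_a$ can be chosen so that this homeomorphism is moreover locally biLipschitz. The generating function of $\mathcal{F}$ is the unique continuous function $u:\mathbb{A}\to\mathbb{R}$, $(\theta,c)\mapsto u(\theta,c)$, that is $C^1$ in the variable $\theta$ and such that, for every $c\in\mathbb{R}$, $u(0,c)=0$ and the graph of $\theta\mapsto c+\frac{\partial u}{\partial\theta}(\theta,c)$ is a leaf of $\mathcal{F}$. An exact symplectic homeomorphism of $\mathbb{A}$ is a homeomorphism that is the limit, for the compact-open topology, of a sequence of smooth diffeomorphisms $f$ of $\mathbb{A}$ such that the 1-form $f^*(r\,d\theta)-r\,d\theta$ is exact. **Proposition 4.** Let $u$ be the generating function of a continuous foliation $\mathcal{F}$ of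 $\mathbb{A}$ into graphs, and assume that $u$ is $C^1$ on $\mathbb{A}$. Then the following two assertions are equivalent: 1. the foliation $\mathcal{F}$ is Lipschitz; 2. all three of the following hold: - $\frac{\partial u}{\partial\theta}$ is locally Lipschitz on $\mathbb{A}$; - for every compact set $C\subset\mathbb{R}$ there is a constant $L$ such that $\theta\mapsto\frac{\partial u}{\partial c}(\theta,c)$ is $L$-Lipschitz on $\mathbb{T}$ for every $c\in C$; - for every compact set $\mathcal{K}\subset\mathbb{A}$ there are constants $k_+>k_->-1$ such that, for Lebesgue almost every point of $\mathcal{K}$, the derivative $\frac{\partial^2u}{\partial\theta\,\partial c}=\frac{\partial}{\partial\theta}\big(\frac{\partial u}{\partial c}\big)$ exists and satisfies $k_-\le\frac{\partial^2u}{\partial\theta\,\partial c}\le k_+$. In this case there is an exact symplectic homeomorphism $\Phi:\mathbb{A}\to\mathbb{A}$ with generating function $u$, i.e. $$\Phi(x,c)=(\theta,r)\iff x=\theta+\frac{\partial u}{\partial c}(\theta,c)\ \text{ and }\ r=c+\frac{\partial u}{\partial\theta}(\theta,c),$$ and $\Phi$ maps the standard foliation by the circles $\mathbb{T}\times\{c\}$,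 $c\in\mathbb{R}$, onto $\mathcal{F}$. -/

import Mathlib

open Filter Topology MeasureTheory
open scoped ContDiff NNReal

/-- The annulus `𝔸 = 𝕋 × ℝ`, with `𝕋 = ℝ / ℤ`. -/
abbrev Annulus : Type := UnitAddCircle × ℝ

namespace Annulus

/-- The universal covering `ℝ² → 𝔸`. -/
def cover (z : ℝ × ℝ) : Annulus := ((z.1 : UnitAddCircle), z.2)

/-- A real function on the annulus is of class `C^n` when its lift to the universal covering is. -/
def IsCn (n : WithTop ℕ∞) (u : Annulus → ℝ) : Prop := ContDiff ℝ n (u ∘ cover)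

/-- The partial derivative `∂u/∂θ` of a function on the annulus. -/
noncomputable def dTheta (u : Annulus → ℝ) (p : Annulus) : ℝ :=
  deriv (fun t : ℝ => u (p.1 + (t : UnitAddCircle), p.2)) 0

/-- The partial derivative `∂u/∂c` of a function on the annulus. -/
noncomputable def dC (u : Annulus → ℝ) (p : Annulus) : ℝ :=
  deriv (fun s : ℝ => u (p.1, s)) p.2

/-- `d` is the value at `p` of the second derivative `∂²u/∂θ∂c = ∂/∂θ (∂u/∂c)`, which exists
there. -/
def HasMixedDerivAt (u : Annulus → ℝ) (d : ℝ) (p : Annulus) : Prop :=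
  HasDerivAt (fun t : ℝ => dC u (p.1 + (t : UnitAddCircle), p.2)) d 0

/-! ### Foliations into graphs -/

/-- The graph of a function `𝕋 → ℝ`, as a subset of the annulus. -/
def graph (η : UnitAddCircle → ℝ) : Set Annulus := {p | p.2 = η p.1}

/-- `Ψ` is the homeomorphism `(θ, a) ↦ (θ, η_a(θ))` of the annulus, and the members of `𝓕` (the
leaves) are the graphs of the functions `η_a`. -/
def Parametrizes (η : ℝ → UnitAddCircle → ℝ) (Ψ : Annulus ≃ₜ Annulus)
    (𝓕 : Set (Set Annulus)) : Prop :=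
  (∀ (θ : UnitAddCircle) (a : ℝ), Ψ (θ, a) = (θ, η a θ)) ∧
    𝓕 = Set.range fun a : ℝ => graph (η a)

/-- `𝓕` is (the set of leaves of) a continuous foliation of the annulus into graphs. -/
def IsGraphFoliation (𝓕 : Set (Set Annulus)) : Prop :=
  ∃ (η : ℝ → UnitAddCircle → ℝ) (Ψ : Annulus ≃ₜ Annulus), Parametrizes η Ψ 𝓕

/-- Every point has a neighbourhood on which `f` is biLipschitz. -/
def LocallyBiLipschitz (f : Annulus → Annulus) : Prop :=
  ∀ p : Annulus, ∃ (K : ℝ≥0), ∃ U ∈ 𝓝 p, ∀ x ∈ U, ∀ y ∈ U,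
    dist (f x) (f y) ≤ K * dist x y ∧ dist x y ≤ K * dist (f x) (f y)

/-- `𝓕` is (the set of leaves of) a Lipschitz foliation of the annulus into graphs. -/
def IsLipschitzFoliation (𝓕 : Set (Set Annulus)) : Prop :=
  ∃ (η : ℝ → UnitAddCircle → ℝ) (Ψ : Annulus ≃ₜ Annulus),
    Parametrizes η Ψ 𝓕 ∧ LocallyBiLipschitz Ψ

/-- `u` is the generating function of the foliation `𝓕`: it is continuous, `C¹` in the variable
`θ`, vanishes on `{0} × ℝ`, and the graph of `c + ∂u/∂θ(·, c)` is a leaf for every `c`. -/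
structure IsFoliationGeneratingFunction (u : Annulus → ℝ) (𝓕 : Set (Set Annulus)) : Prop where
  continuous : Continuous u
  contDiff_theta : ∀ c : ℝ, ContDiff ℝ 1 fun t : ℝ => u ((t : UnitAddCircle), c)
  zero_left : ∀ c : ℝ, u (0, c) = 0
  leaf : ∀ c : ℝ, graph (fun θ => c + dTheta u (θ, c)) ∈ 𝓕

/-! ### Exact symplectic homeomorphisms -/

/-- `f` is an exact symplectic (`C^∞`) diffeomorphism of the annulus: `f` and `f⁻¹` have smooth
lifts to `ℝ²`, and there is a smooth function `S` on the annulus with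
`f^*(r dθ) - r dθ = dS`, written here on the universal covering. -/
def IsExactSymplecticDiffeo (f : Annulus ≃ₜ Annulus) : Prop :=
  (∃ G : ℝ × ℝ → ℝ × ℝ, ContDiff ℝ ∞ G ∧ ∀ z, cover (G z) = f.symm (cover z)) ∧
  ∃ F : ℝ × ℝ → ℝ × ℝ, ContDiff ℝ ∞ F ∧ (∀ z, cover (F z) = f (cover z)) ∧
    ∃ S : Annulus → ℝ, IsCn ∞ S ∧ ∀ z v : ℝ × ℝ,
      (F z).2 * (fderiv ℝ F z v).1 - z.2 * v.1 = fderiv ℝ (S ∘ cover) z v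

/-- `Φ` is an exact symplectic homeomorphism of the annulus: a homeomorphism that is a limit, for
the compact-open topology (the topology of `C(𝔸, 𝔸)`), of exact symplectic diffeomorphisms. -/
def IsExactSymplecticHomeo (Φ : Annulus ≃ₜ Annulus) : Prop :=
  ∃ f : ℕ → (Annulus ≃ₜ Annulus), (∀ n, IsExactSymplecticDiffeo (f n)) ∧
    Tendsto (fun n => (⟨f n, (f n).continuous⟩ : C(Annulus, Annulus))) atTop
      (𝓝 ⟨Φ, Φ.continuous⟩)

/-- `u` is a generating function of `Φ`:
`Φ(x, c) = (θ, r) ↔ x = θ + ∂u/∂c(θ, c) and r = c + ∂u/∂θ(θ, c)`. -/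
def Generates (u : Annulus → ℝ) (Φ : Annulus ≃ₜ Annulus) : Prop :=
  ∀ (x θ : UnitAddCircle) (c r : ℝ), Φ (x, c) = (θ, r) ↔
    x = θ + (dC u (θ, c) : UnitAddCircle) ∧ r = c + dTheta u (θ, c)

/-- `Φ` maps the standard foliation, by the circles `𝕋 × {c}`, onto `𝓕`. -/
def MapsStandardFoliationOnto (Φ : Annulus ≃ₜ Annulus) (𝓕 : Set (Set Annulus)) : Prop :=
  (Set.range fun c : ℝ => Φ '' {p : Annulus | p.2 = c}) = 𝓕

end Annulus

/-! The bridge between the two assertions is the mixed increment V(t₂,c₂) − V(t₁,c₂) − V(t₂,c₁) +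
V(t₁,c₁) of the lift V of u. Bounding it below by k times the area of the rectangle (`RectGE`)
amounts to saying that c ↦ ∂V/∂θ has slopes at least k, and equally that θ ↦ ∂V/∂c does: integrate
one way, shrink a side of the rectangle the other way. This replaces the symmetry of second
derivatives, unavailable for a C¹ function.

Since ∂u/∂θ has mean zero, the leaf of c has mean c. Hence c parametrizes the foliation,
increasingly on each fibre. If some parametrization is locally biLipschitz, the vertical gaps
between two leaves are mutually comparable; their mean is c' − c, so each lies between K⁻²(c' − c)
and K²(c' − c). Through rectangles these become slope bounds for θ ↦ ∂u/∂c, with lower slope above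
−1 (`IsLipschitzFoliation.hasUniformSlopes`), and Rademacher and Fubini give the almost everywhere
bounds. Conversely, a Lipschitz function is the integral of its derivative, so the almost everywhere
bound gives slopes at least k₋ > −1 on almost every circle, then on all by continuity. Back through
rectangles, gaps between leaves are bounded below by a multiple of c' − c; with ∂u/∂θ locally
Lipschitz, the parametrization by c is biLipschitz (`locallyBiLipschitz_of_isTwist`).

The same bounds make G(θ,c) = (θ + ∂u/∂c, c) and H(θ,c) = (θ, c + ∂u/∂θ) homeomorphisms of the
plane, and Φ is induced by H ∘ G⁻¹. Mollifying V keeps periodicity and the rectangle bounds, so it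
yields exact symplectic diffeomorphisms; they converge to Φ because the lower slope bound controls
G⁻¹. -/

namespace Annulus

/-! ### Calculus of functions of two real variables -/

/-- The partial derivative of a function of two real variables in the first variable. -/
noncomputable def partialFst (V : ℝ × ℝ → ℝ) (z : ℝ × ℝ) : ℝ := fderiv ℝ V z (1, 0)

/-- The partial derivative of a function of two real variables in the second variable. -/
noncomputable def partialSnd (V : ℝ × ℝ → ℝ) (z : ℝ × ℝ) : ℝ := fderiv ℝ V z (0, 1)

/-- A function on the plane is periodic when it is invariant under `(t, c) ↦ (t + 1, c)`. -/
def IsPeriodic (V : ℝ × ℝ → ℝ) : Prop := ∀ t c, V (t + 1, c) = V (t, c)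

section PartialDerivatives

variable {V : ℝ × ℝ → ℝ}

theorem hasDerivAt_line (hV : ContDiff ℝ 1 V) (z v : ℝ × ℝ) :
    HasDerivAt (fun s : ℝ => V (z + s • v)) (fderiv ℝ V z v) 0 := by
  have h1 : HasFDerivAt V (fderiv ℝ V z) (z + (0 : ℝ) • v) := by
    simpa using (hV.differentiable (by norm_num) z).hasFDerivAt
  have h2 : HasDerivAt (fun s : ℝ => z + s • v) v 0 := by
    simpa using ((hasDerivAt_id (0 : ℝ)).smul_const v).const_add z
  exact h1.comp_hasDerivAt 0 h2

theorem hasDerivAt_fst (hV : ContDiff ℝ 1 V) (t c : ℝ) :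
    HasDerivAt (fun t => V (t, c)) (partialFst V (t, c)) t :=
  (hV.differentiable (by norm_num) (t, c)).hasFDerivAt.comp_hasDerivAt t
    ((hasDerivAt_id t).prodMk (hasDerivAt_const t c))

theorem hasDerivAt_snd (hV : ContDiff ℝ 1 V) (t c : ℝ) :
    HasDerivAt (fun c => V (t, c)) (partialSnd V (t, c)) c :=
  (hV.differentiable (by norm_num) (t, c)).hasFDerivAt.comp_hasDerivAt c
    ((hasDerivAt_const c t).prodMk (hasDerivAt_id c))

theorem fderiv_apply_eq_partial (z v : ℝ × ℝ) :
    fderiv ℝ V z v = partialFst V z * v.1 + partialSnd V z * v.2 := by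
  have : v = v.1 • ((1 : ℝ), (0 : ℝ)) + v.2 • ((0 : ℝ), (1 : ℝ)) := by ext <;> simp
  conv_lhs => rw [this]
  rw [map_add, map_smul, map_smul, partialFst, partialSnd]
  simp [mul_comm]

theorem continuous_partialFst (hV : ContDiff ℝ 1 V) : Continuous (partialFst V) :=
  (hV.continuous_fderiv (by norm_num)).clm_apply continuous_const

theorem continuous_partialSnd (hV : ContDiff ℝ 1 V) : Continuous (partialSnd V) :=
  (hV.continuous_fderiv (by norm_num)).clm_apply continuous_const

theorem contDiff_partialFst (hV : ContDiff ℝ ∞ V) : ContDiff ℝ ∞ (partialFst V) :=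
  (hV.fderiv_right (by simp)).clm_apply contDiff_const

theorem contDiff_partialSnd (hV : ContDiff ℝ ∞ V) : ContDiff ℝ ∞ (partialSnd V) :=
  (hV.fderiv_right (by simp)).clm_apply contDiff_const

theorem IsPeriodic.fderiv (hp : IsPeriodic V) (t c : ℝ) :
    fderiv ℝ V (t + 1, c) = fderiv ℝ V (t, c) := by
  have h : (fun z : ℝ × ℝ => V (z + (1, 0))) = V := by
    funext z
    have e : z + (1, 0) = (z.1 + 1, z.2) := by ext <;> simp
    rw [e]
    exact hp z.1 z.2
  have := fderiv_comp_add_right (𝕜 := ℝ) (f := V) (x := (t, c)) ((1 : ℝ), (0 : ℝ))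
  rw [h] at this
  simpa using this.symm

theorem IsPeriodic.partialFst (hp : IsPeriodic V) : IsPeriodic (partialFst V) := fun t c => by
  simp only [Annulus.partialFst, hp.fderiv]

theorem IsPeriodic.partialSnd (hp : IsPeriodic V) : IsPeriodic (partialSnd V) := fun t c => by
  simp only [Annulus.partialSnd, hp.fderiv]

theorem IsPeriodic.add_int (hp : IsPeriodic V) (t c : ℝ) (n : ℤ) : V (t + n, c) = V (t, c) := by
  have h : Function.Periodic (fun t => V (t, c)) 1 := fun t => hp t c
  simpa using h.int_mul n t

/-- A continuous periodic function is uniformly continuous on horizontal strips. -/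
theorem IsPeriodic.uniformContinuous_strip (hp : IsPeriodic V) (hV : Continuous V) (R : ℝ)
    {ε : ℝ} (hε : 0 < ε) :
    ∃ δ > 0, ∀ z w : ℝ × ℝ, |z.2| ≤ R → dist z w < δ → dist (V z) (V w) < ε := by
  have hK : IsCompact (Set.Icc (0 : ℝ) 1 ×ˢ Set.Icc (-R) R) := isCompact_Icc.prod isCompact_Icc
  have := hK.uniformContinuousAt_of_continuousAt V (fun z _ => hV.continuousAt)
    (Metric.dist_mem_uniformity hε)
  obtain ⟨δ, hδ, h⟩ := Metric.mem_uniformity_dist.1 this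
  refine ⟨δ, hδ, fun z w hz hzw => ?_⟩
  -- Translating both points by the same integer keeps their distance and brings z into the compact
  -- rectangle; w may stay outside it.
  have e1 : V (z.1 + ((-⌊z.1⌋ : ℤ) : ℝ), z.2) = V z := hp.add_int _ _ _
  have e2 : V (w.1 + ((-⌊z.1⌋ : ℤ) : ℝ), w.2) = V w := hp.add_int _ _ _
  rw [← e1, ← e2]
  refine h (a := (_, _)) (b := (_, _)) ?_ ⟨⟨?_, ?_⟩, abs_le.1 hz⟩
  · simpa [Prod.dist_eq] using hzw
  · push_cast; linarith [Int.floor_le z.1]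
  · push_cast; linarith [Int.lt_floor_add_one z.1]

end PartialDerivatives

/-! ### Lower bounds for mixed second differences -/

/-- A right-sided lower bound on increments bounds the derivative. -/
theorem le_of_hasDerivAt_of_forall_gt {f : ℝ → ℝ} {a k x y : ℝ} (hf : HasDerivAt f a x)
    (hxy : x < y) (h : ∀ s, x < s → s < y → k * (s - x) ≤ f s - f x) : k ≤ a := by
  have ht : Tendsto (slope f x) (𝓝[>] x) (𝓝 a) :=
    (hasDerivAt_iff_tendsto_slope.1 hf).mono_left
      (nhdsWithin_mono _ fun s (hs : x < s) => hs.ne')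
  refine ge_of_tendsto ht ?_
  filter_upwards [Ioo_mem_nhdsGT hxy] with s hs
  rw [slope_def_field, le_div_iff₀ (sub_pos.2 hs.1)]
  exact h s hs.1 hs.2

/-- The increments of `V` over rectangles `[t₁, t₂] × [c₁, c₂]` with `c₁, c₂ ∈ s` are at least
`k` times the area. -/
def RectGE (V : ℝ × ℝ → ℝ) (k : ℝ) (s : Set ℝ) : Prop :=
  ∀ t₁ t₂ c₁ c₂, t₁ ≤ t₂ → c₁ ≤ c₂ → c₁ ∈ s → c₂ ∈ s →
    k * (t₂ - t₁) * (c₂ - c₁) ≤ V (t₂, c₂) - V (t₁, c₂) - (V (t₂, c₁) - V (t₁, c₁))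

section RectGE

variable {V : ℝ × ℝ → ℝ} {k : ℝ} {s : Set ℝ}

/-- Mean value inequality in t for the difference of V along two horizontal lines. -/
theorem RectGE.of_partialFst (hV : ContDiff ℝ 1 V)
    (h : ∀ t, ∀ c₁ ∈ s, ∀ c₂ ∈ s, c₁ ≤ c₂ →
      k * (c₂ - c₁) ≤ partialFst V (t, c₂) - partialFst V (t, c₁)) : RectGE V k s := by
  intro t₁ t₂ c₁ c₂ ht hc h1 h2
  have hd : ∀ t, HasDerivAt (fun t => V (t, c₂) - V (t, c₁))
      (partialFst V (t, c₂) - partialFst V (t, c₁)) t := fun t =>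
    (hasDerivAt_fst hV t c₂).sub (hasDerivAt_fst hV t c₁)
  have := mul_sub_le_image_sub_of_le_deriv (C := k * (c₂ - c₁))
    (fun t => (hd t).differentiableAt)
    (fun t => by rw [(hd t).deriv]; exact h t c₁ h1 c₂ h2 hc) ht
  linarith

theorem RectGE.of_partialSnd (hV : ContDiff ℝ 1 V) (hs : Convex ℝ s)
    (h : ∀ c ∈ s, ∀ t₁ t₂, t₁ ≤ t₂ →
      k * (t₂ - t₁) ≤ partialSnd V (t₂, c) - partialSnd V (t₁, c)) : RectGE V k s := by
  intro t₁ t₂ c₁ c₂ ht hc h1 h2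
  have hd : ∀ c, HasDerivAt (fun c => V (t₂, c) - V (t₁, c))
      (partialSnd V (t₂, c) - partialSnd V (t₁, c)) c := fun c =>
    (hasDerivAt_snd hV t₂ c).sub (hasDerivAt_snd hV t₁ c)
  have := hs.mul_sub_le_image_sub_of_le_deriv (C := k * (t₂ - t₁))
    (f := fun c => V (t₂, c) - V (t₁, c))
    (fun c _ => (hd c).continuousAt.continuousWithinAt)
    (fun c _ => (hd c).differentiableAt.differentiableWithinAt)
    (fun c hc => by rw [(hd c).deriv]; exact h c (interior_subset hc) t₁ t₂ ht) c₁ h1 c₂ h2 hc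
  exact this

/-- Divide by the width of the rectangle and let it shrink. Together with `RectGE.of_partialSnd`,
this transfers slope bounds from one partial derivative to the other. -/
theorem RectGE.partialFst (h : RectGE V k s) (hV : ContDiff ℝ 1 V) {t c₁ c₂ : ℝ} (h1 : c₁ ∈ s)
    (h2 : c₂ ∈ s) (hc : c₁ ≤ c₂) :
    k * (c₂ - c₁) ≤ partialFst V (t, c₂) - partialFst V (t, c₁) := by
  refine le_of_hasDerivAt_of_forall_gt (f := fun t => V (t, c₂) - V (t, c₁))
    ((hasDerivAt_fst hV t c₂).sub (hasDerivAt_fst hV t c₁)) (lt_add_one t) fun r hr _ => ?_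
  have := h t r c₁ c₂ hr.le hc h1 h2
  linarith

/-- Here it is the height that shrinks, which needs room in `s` above `c`; hence the neighbourhood
hypothesis. -/
theorem RectGE.partialSnd (h : RectGE V k s) (hV : ContDiff ℝ 1 V) {c t₁ t₂ : ℝ} (hc : s ∈ 𝓝 c)
    (ht : t₁ ≤ t₂) : k * (t₂ - t₁) ≤ partialSnd V (t₂, c) - partialSnd V (t₁, c) := by
  obtain ⟨ε, hε, hs⟩ := Metric.mem_nhds_iff.1 hc
  refine le_of_hasDerivAt_of_forall_gt (f := fun c => V (t₂, c) - V (t₁, c)) (y := c + ε)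
    ((hasDerivAt_snd hV t₂ c).sub (hasDerivAt_snd hV t₁ c)) (by linarith) fun r hr hr' => ?_
  have := h t₁ t₂ c r ht hr.le (mem_of_mem_nhds hc)
    (hs (by rw [Metric.mem_ball, Real.dist_eq, abs_lt]; constructor <;> linarith))
  linarith

end RectGE

theorem partialFst_neg (V : ℝ × ℝ → ℝ) (z : ℝ × ℝ) : partialFst (-V) z = -partialFst V z := by
  simp [partialFst, fderiv_neg]

theorem partialSnd_neg (V : ℝ × ℝ → ℝ) (z : ℝ × ℝ) : partialSnd (-V) z = -partialSnd V z := by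
  simp [partialSnd, fderiv_neg]

/-! ### Mollification -/

/-- The mollification of a function on the plane by a normalized bump function. -/
noncomputable def mollify (φ : ContDiffBump (0 : ℝ × ℝ)) (W : ℝ × ℝ → ℝ) (x : ℝ × ℝ) : ℝ :=
  ∫ y, φ.normed volume y * W (x - y)

section Mollify

variable (φ : ContDiffBump (0 : ℝ × ℝ)) {V W : ℝ × ℝ → ℝ}

theorem mollify_eq_convolution (W : ℝ × ℝ → ℝ) :
    mollify φ W = convolution (φ.normed volume) W (ContinuousLinearMap.lsmul ℝ ℝ) volume := by
  funext x
  simp [mollify, convolution]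

theorem integrable_mollify (hW : Continuous W) (x : ℝ × ℝ) :
    Integrable fun y => φ.normed volume y * W (x - y) :=
  (φ.continuous_normed.mul (by fun_prop)).integrable_of_hasCompactSupport
    φ.hasCompactSupport_normed.mul_right

theorem contDiff_mollify (hW : Continuous W) : ContDiff ℝ ∞ (mollify φ W) := by
  rw [mollify_eq_convolution]
  exact φ.hasCompactSupport_normed.contDiff_convolution_left _ φ.contDiff_normed
    hW.locallyIntegrable

theorem IsPeriodic.mollify (hW : IsPeriodic W) : IsPeriodic (mollify φ W) := fun t c => by
  simp only [Annulus.mollify]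
  congr 1
  funext y
  congr 1
  have e : (t + 1, c) - y = (t - y.1 + 1, c - y.2) := by ext <;> simp; ring
  rw [e]
  exact hW (t - y.1) (c - y.2)

theorem dist_mollify_le (hW : Continuous W) {x : ℝ × ℝ} {ε : ℝ}
    (h : ∀ y, dist y x < φ.rOut → dist (W y) (W x) ≤ ε) : dist (mollify φ W x) (W x) ≤ ε := by
  rw [mollify_eq_convolution]
  exact φ.dist_normed_convolution_le hW.aestronglyMeasurable fun y hy => h y hy

theorem le_mollify (hW : Continuous W) {x : ℝ × ℝ} {a : ℝ}
    (h : ∀ y, dist y x < φ.rOut → a ≤ W y) : a ≤ mollify φ W x := by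
  have h1 : ∫ y, φ.normed volume y * a = a := by
    rw [integral_mul_const, φ.integral_normed, one_mul]
  rw [← h1]
  refine integral_mono ((φ.integrable_normed (μ := volume)).mul_const a)
    (integrable_mollify φ hW x) fun y => ?_
  by_cases hy : y ∈ Function.support (φ.normed (volume : Measure (ℝ × ℝ)))
  · rw [φ.support_normed_eq, Metric.mem_ball, dist_zero_right] at hy
    refine mul_le_mul_of_nonneg_left (h _ ?_) (φ.nonneg_normed y)
    simpa [dist_eq_norm] using hy
  · rw [Function.notMem_support] at hy
    simp [hy]

theorem fderiv_mollify (hV : ContDiff ℝ 1 V) (x v : ℝ × ℝ) :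
    fderiv ℝ (mollify φ V) x v = mollify φ (fun z => fderiv ℝ V z v) x := by
  have hVc := hV.continuous
  have hdc : Continuous fun z => fderiv ℝ V z v :=
    (hV.continuous_fderiv (by norm_num)).clm_apply continuous_const
  have hS : ContDiff ℝ 1 (mollify φ V) := (contDiff_mollify φ hVc).of_le (by simp)
  -- The derivative is evaluated only at x + s v − y with |s| ≤ 1 and y in the support of the bump.
  -- This set is compact, which supplies the dominating constant.
  have hK : IsCompact ((fun p : ℝ × (ℝ × ℝ) => x + p.1 • v - p.2) ''
      (Set.Icc (-1 : ℝ) 1 ×ˢ tsupport (φ.normed (volume : Measure (ℝ × ℝ))))) :=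
    (isCompact_Icc.prod φ.hasCompactSupport_normed).image (by fun_prop)
  obtain ⟨B, hB⟩ := hK.exists_bound_of_continuousOn hdc.continuousOn
  have key := (hasDerivAt_integral_of_dominated_loc_of_deriv_le (μ := volume) (x₀ := (0 : ℝ))
    (s := Set.Icc (-1 : ℝ) 1) (Icc_mem_nhds (by norm_num) (by norm_num))
    (F := fun (s : ℝ) y => φ.normed volume y * V (x + s • v - y))
    (F' := fun (s : ℝ) y => φ.normed volume y * fderiv ℝ V (x + s • v - y) v)
    (bound := fun y => φ.normed volume y * B)
    (Eventually.of_forall fun s => (integrable_mollify φ hVc _).aestronglyMeasurable)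
    (integrable_mollify φ hVc _) (integrable_mollify φ hdc _).aestronglyMeasurable
    (Eventually.of_forall fun y s hs => ?_) ((φ.integrable_normed (μ := volume)).mul_const B)
    (Eventually.of_forall fun y s _ => ?_)).2
  · refine (hasDerivAt_line hS x v).unique ?_
    simpa [mollify] using key
  · rw [norm_mul, Real.norm_of_nonneg (φ.nonneg_normed y)]
    by_cases hy : y ∈ tsupport (φ.normed (volume : Measure (ℝ × ℝ)))
    · exact mul_le_mul_of_nonneg_left (hB _ ⟨(s, y), ⟨hs, hy⟩, rfl⟩) (φ.nonneg_normed y)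
    · rw [image_eq_zero_of_notMem_tsupport hy]
      simp
  · refine HasDerivAt.const_mul _ ?_
    have h2 : HasDerivAt (fun s : ℝ => x + s • v - y) v s := by
      simpa using (((hasDerivAt_id s).smul_const v).const_add x).sub_const y
    exact (hV.differentiable (by norm_num) _).hasFDerivAt.comp_hasDerivAt s h2

theorem partialFst_mollify (hV : ContDiff ℝ 1 V) (x : ℝ × ℝ) :
    partialFst (mollify φ V) x = mollify φ (partialFst V) x := fderiv_mollify φ hV x _

theorem partialSnd_mollify (hV : ContDiff ℝ 1 V) (x : ℝ × ℝ) :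
    partialSnd (mollify φ V) x = mollify φ (partialSnd V) x := fderiv_mollify φ hV x _

/-- The increment of the mollification averages increments of V over translated rectangles of the
same area, so k survives; only the range of heights shrinks. -/
theorem RectGE.mollify {k : ℝ} {s s' : Set ℝ} (h : RectGE V k s) (hV : Continuous V)
    (hs : ∀ c ∈ s', ∀ d, |d| < φ.rOut → c - d ∈ s) : RectGE (mollify φ V) k s' := by
  intro t₁ t₂ c₁ c₂ ht hc h1 h2
  have hi := fun z => integrable_mollify φ hV z
  have hi2 : ∀ z w, Integrable fun y =>
      φ.normed volume y * V (z - y) - φ.normed volume y * V (w - y) :=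
    fun z w => (hi z).sub (hi w)
  have e : Annulus.mollify φ V (t₂, c₂) - Annulus.mollify φ V (t₁, c₂)
      - (Annulus.mollify φ V (t₂, c₁) - Annulus.mollify φ V (t₁, c₁)) =
      ∫ y, φ.normed volume y * (V ((t₂, c₂) - y) - V ((t₁, c₂) - y)
        - (V ((t₂, c₁) - y) - V ((t₁, c₁) - y))) := by
    simp only [Annulus.mollify]
    rw [← integral_sub (hi _) (hi _), ← integral_sub (hi _) (hi _),
      ← integral_sub (hi2 _ _) (hi2 _ _)]
    congr 1
    funext y
    ring
  rw [e, ← one_mul (k * (t₂ - t₁) * (c₂ - c₁)), ← φ.integral_normed (μ := volume),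
    ← integral_mul_const]
  refine integral_mono ((φ.integrable_normed (μ := volume)).mul_const _) ?_ fun y => ?_
  · exact ((hi2 (t₂, c₂) (t₁, c₂)).sub (hi2 (t₂, c₁) (t₁, c₁))).congr
      (Eventually.of_forall fun y => by simp only [Pi.sub_apply]; ring)
  · by_cases hy : y ∈ Function.support (φ.normed (volume : Measure (ℝ × ℝ)))
    · rw [φ.support_normed_eq, Metric.mem_ball, dist_zero_right] at hy
      refine mul_le_mul_of_nonneg_left ?_ (φ.nonneg_normed y)
      have hy2 : |y.2| < φ.rOut := (norm_snd_le y).trans_lt hy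
      have := h (t₁ - y.1) (t₂ - y.1) (c₁ - y.2) (c₂ - y.2) (by linarith) (by linarith)
        (hs _ h1 _ hy2) (hs _ h2 _ hy2)
      simp only [sub_sub_sub_cancel_right] at this
      exact this
    · rw [Function.notMem_support] at hy
      simp [hy]

end Mollify

end Annulus

namespace Annulus

/-! ### The universal covering -/

theorem isOpenQuotientMap_cover : IsOpenQuotientMap cover :=
  (QuotientAddGroup.isOpenQuotientMap_mk (N := AddSubgroup.zmultiples (1 : ℝ))).prodMap .id

theorem continuous_cover : Continuous cover := isOpenQuotientMap_cover.continuous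

theorem surjective_cover : Function.Surjective cover := isOpenQuotientMap_cover.surjective

theorem cover_eq_cover_iff {z w : ℝ × ℝ} :
    cover z = cover w ↔ ∃ n : ℤ, w = (z.1 + n, z.2) := by
  simp only [cover, Prod.ext_iff]
  rw [QuotientAddGroup.eq, AddSubgroup.mem_zmultiples_iff]
  constructor
  · rintro ⟨⟨n, hn⟩, h⟩
    exact ⟨n, by simp only [zsmul_eq_mul, mul_one] at hn; linarith, h.symm⟩
  · rintro ⟨n, h1, h2⟩
    exact ⟨⟨n, by simp only [zsmul_eq_mul, mul_one]; linarith⟩, h2.symm⟩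

theorem cover_add_one (t c : ℝ) : cover (t + 1, c) = cover (t, c) :=
  (cover_eq_cover_iff.2 ⟨1, by simp⟩).symm

theorem isPeriodic_comp_cover (u : Annulus → ℝ) : IsPeriodic (u ∘ cover) := fun t c => by
  simp [cover_add_one]

theorem norm_coe_le_abs (x : ℝ) : ‖(x : UnitAddCircle)‖ ≤ |x| := by
  rw [UnitAddCircle.norm_eq]
  simpa using round_le x 0

theorem dist_coe_le (x y : ℝ) : dist (x : UnitAddCircle) y ≤ |x - y| := by
  rw [dist_eq_norm, ← AddCircle.coe_sub]
  exact norm_coe_le_abs _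

theorem dist_cover_le (z w : ℝ × ℝ) : dist (cover z) (cover w) ≤ dist z w := by
  rw [Prod.dist_eq, Prod.dist_eq]
  exact max_le_max (dist_coe_le _ _) le_rfl

/-- Two points of the circle have lifts at the same distance. -/
theorem exists_lift_dist (θ θ' : UnitAddCircle) :
    ∃ x y : ℝ, (x : UnitAddCircle) = θ ∧ (y : UnitAddCircle) = θ' ∧ |x - y| = dist θ θ' := by
  obtain ⟨x, rfl⟩ := QuotientAddGroup.mk_surjective θ
  obtain ⟨y, rfl⟩ := QuotientAddGroup.mk_surjective θ'
  refine ⟨x, y + round (x - y), rfl, ?_, ?_⟩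
  · have := (cover_eq_cover_iff (z := (y, (0 : ℝ)))).2 ⟨round (x - y), rfl⟩
    exact (congrArg Prod.fst this).symm
  · have : dist (x : UnitAddCircle) y = |x - y - round (x - y)| := by
      rw [dist_eq_norm, ← AddCircle.coe_sub, UnitAddCircle.norm_eq]
    refine Eq.trans ?_ this.symm
    congr 1
    ring

theorem IsPeriodic.exists_eq_comp_cover {V : ℝ × ℝ → ℝ} (hV : IsPeriodic V) :
    ∃ S : Annulus → ℝ, S ∘ cover = V := by
  refine ⟨fun p => V (Function.surjInv surjective_cover p), funext fun z => ?_⟩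
  obtain ⟨n, hn⟩ := cover_eq_cover_iff.1 (Function.surjInv_eq surjective_cover (cover z))
  have := hV.add_int (Function.surjInv surjective_cover (cover z)).1
    (Function.surjInv surjective_cover (cover z)).2 n
  rw [← hn] at this
  exact this.symm

/-- A continuous map of the plane commuting with the deck transformations descends. -/
theorem exists_descend {F : ℝ × ℝ → ℝ × ℝ} (hF : Continuous F)
    (h : ∀ t c, F (t + 1, c) = ((F (t, c)).1 + 1, (F (t, c)).2)) :
    ∃ f : Annulus → Annulus, Continuous f ∧ ∀ z, f (cover z) = cover (F z) := by
  have hper : Function.FactorsThrough (cover ∘ F) cover := by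
    intro z w hzw
    obtain ⟨n, rfl⟩ := cover_eq_cover_iff.1 hzw
    have : Function.Periodic (fun t => cover (F (t, z.2))) 1 := fun t => by
      simp only [h, cover_add_one]
    simpa using (this.int_mul n z.1).symm
  have hf : ∀ z, cover (F (Function.surjInv surjective_cover (cover z))) = cover (F z) :=
    fun z => hper (Function.surjInv_eq surjective_cover _)
  refine ⟨fun p => cover (F (Function.surjInv surjective_cover p)), ?_, hf⟩
  rw [isOpenQuotientMap_cover.isQuotientMap.continuous_iff]
  exact (continuous_cover.comp hF).congr fun z => (hf z).symm

theorem symm_add_one {F : ℝ × ℝ ≃ₜ ℝ × ℝ}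
    (h : ∀ t c, F (t + 1, c) = ((F (t, c)).1 + 1, (F (t, c)).2)) (t c : ℝ) :
    F.symm (t + 1, c) = ((F.symm (t, c)).1 + 1, (F.symm (t, c)).2) := by
  rw [Homeomorph.symm_apply_eq, h]
  simp

/-- A homeomorphism of the plane commuting with the deck transformations descends. -/
theorem exists_homeomorph_descend (F : ℝ × ℝ ≃ₜ ℝ × ℝ)
    (h : ∀ t c, F (t + 1, c) = ((F (t, c)).1 + 1, (F (t, c)).2)) :
    ∃ f : Annulus ≃ₜ Annulus, ∀ z, f (cover z) = cover (F z) := by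
  obtain ⟨f, hf, hfc⟩ := exists_descend F.continuous h
  obtain ⟨g, hg, hgc⟩ := exists_descend F.symm.continuous (symm_add_one h)
  refine ⟨⟨⟨f, g, fun p => ?_, fun p => ?_⟩, hf, hg⟩, hfc⟩ <;>
  · obtain ⟨z, rfl⟩ := surjective_cover p
    simp [hfc, hgc]

/-! ### Fibrewise homeomorphisms of the plane -/

/-- A continuous map of the plane preserving the vertical lines, and inducing on each of them an
increasing bijection, is a homeomorphism. -/
theorem exists_fiberwise_homeomorph {f : ℝ × ℝ → ℝ} (hf : Continuous f)
    (hm : ∀ a, StrictMono fun b => f (a, b)) (hs : ∀ a, Function.Surjective fun b => f (a, b)) :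
    ∃ F : ℝ × ℝ ≃ₜ ℝ × ℝ, ∀ z, F z = (z.1, f z) := by
  choose g hg using hs
  simp only at hg
  have hg' : ∀ a b, g a (f (a, b)) = b := fun a b => (hm a).injective (hg a _)
  refine ⟨⟨⟨fun z => (z.1, f z), fun z => (z.1, g z.1 z.2), fun z => by simp [hg'],
    fun z => by simp [hg]⟩, by fun_prop, ?_⟩, fun z => rfl⟩
  refine continuous_fst.prodMk (continuous_iff_continuousAt.2 fun z => ?_)
  -- By monotonicity on fibres, a strict bound b on the inverse at w amounts to a strict inequality
  -- between f(w.1, b) and w.2, an open condition on w.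
  rw [ContinuousAt, tendsto_order]
  constructor
  · intro b hb
    have h1 : f (z.1, b) < z.2 := by
      rw [← hg z.1 z.2]
      exact hm z.1 hb
    have h2 : ∀ᶠ w : ℝ × ℝ in 𝓝 z, f (w.1, b) < w.2 :=
      ContinuousAt.eventually_lt (by fun_prop) continuousAt_snd h1
    filter_upwards [h2] with w hw
    rw [← hg w.1 w.2] at hw
    exact (hm w.1).lt_iff_lt.1 hw
  · intro b hb
    have h1 : z.2 < f (z.1, b) := by
      rw [← hg z.1 z.2]
      exact hm z.1 hb
    have h2 : ∀ᶠ w : ℝ × ℝ in 𝓝 z, w.2 < f (w.1, b) :=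
      ContinuousAt.eventually_lt continuousAt_snd (by fun_prop) h1
    filter_upwards [h2] with w hw
    rw [← hg w.1 w.2] at hw
    exact (hm w.1).lt_iff_lt.1 hw

theorem contDiff_symm_of_injective_fderiv (F : ℝ × ℝ ≃ₜ ℝ × ℝ) (hF : ContDiff ℝ ∞ F)
    (h : ∀ z v, fderiv ℝ F z v = 0 → v = 0) : ContDiff ℝ ∞ F.symm := by
  have hi : ∀ z, Function.Injective (fderiv ℝ F z : ℝ × ℝ →ₗ[ℝ] ℝ × ℝ) := fun z =>
    (injective_iff_map_eq_zero _).2 (h z)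
  refine F.contDiff_symm
    (f₀' := fun z => (LinearEquiv.ofInjectiveEndo _ (hi z)).toContinuousLinearEquiv)
    (fun z => ?_) hF
  have : ((LinearEquiv.ofInjectiveEndo _ (hi z)).toContinuousLinearEquiv :
      ℝ × ℝ →L[ℝ] ℝ × ℝ) = fderiv ℝ F z := by
    ext <;> rfl
  rw [this]
  exact (hF.differentiable (by simp) z).hasFDerivAt

/-! ### Generating functions on the plane -/

/-- The generating functions `V`, periodic in the first variable, for which
`(t + ∂₂V, c) ↦ (t, c + ∂₁V)` is a homeomorphism. -/
structure IsTwist (V : ℝ × ℝ → ℝ) : Prop where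
  contDiff : ContDiff ℝ 1 V
  periodic : IsPeriodic V
  rectGE : ∀ R : ℝ, ∃ m > 0, RectGE V (m - 1) (Set.Icc (-R) R)
  surjective : ∀ t, Function.Surjective fun c => c + partialFst V (t, c)

namespace IsTwist

variable {V : ℝ × ℝ → ℝ}

theorem le_partialSnd (hV : IsTwist V) (R : ℝ) :
    ∃ m > 0, ∀ c, |c| ≤ R → ∀ t₁ t₂, t₁ ≤ t₂ →
      m * (t₂ - t₁) ≤ t₂ + partialSnd V (t₂, c) - (t₁ + partialSnd V (t₁, c)) := by
  -- The enlarged strip is a neighbourhood of every height c with |c| ≤ R.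
  obtain ⟨m, hm, h⟩ := hV.rectGE (R + 1)
  refine ⟨m, hm, fun c hc t₁ t₂ ht => ?_⟩
  rw [abs_le] at hc
  have := h.partialSnd hV.contDiff (c := c) (Icc_mem_nhds (by linarith) (by linarith)) ht
  linarith

theorem le_partialFst (hV : IsTwist V) (R : ℝ) :
    ∃ m > 0, ∀ t c₁ c₂, |c₁| ≤ R → |c₂| ≤ R → c₁ ≤ c₂ →
      m * (c₂ - c₁) ≤ c₂ + partialFst V (t, c₂) - (c₁ + partialFst V (t, c₁)) := by
  obtain ⟨m, hm, h⟩ := hV.rectGE R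
  refine ⟨m, hm, fun t c₁ c₂ h1 h2 hc => ?_⟩
  have := h.partialFst hV.contDiff (t := t) (abs_le.1 h1) (abs_le.1 h2) hc
  linarith

theorem strictMono_fst (hV : IsTwist V) (c : ℝ) :
    StrictMono fun t => t + partialSnd V (t, c) := by
  intro t₁ t₂ ht
  obtain ⟨m, hm, h⟩ := hV.le_partialSnd |c|
  have := h c le_rfl t₁ t₂ ht.le
  have := mul_pos hm (sub_pos.2 ht)
  simp only
  linarith

theorem strictMono_snd (hV : IsTwist V) (t : ℝ) :
    StrictMono fun c => c + partialFst V (t, c) := by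
  intro c₁ c₂ hc
  obtain ⟨m, hm, h⟩ := hV.le_partialFst (max |c₁| |c₂|)
  have := h t c₁ c₂ (le_max_left _ _) (le_max_right _ _) hc.le
  have := mul_pos hm (sub_pos.2 hc)
  simp only
  linarith

/-- Periodicity of ∂₂V makes the map a monotone lift of degree one, which is onto when continuous.
-/
theorem surjective_fst (hV : IsTwist V) (c : ℝ) :
    Function.Surjective fun t => t + partialSnd V (t, c) := by
  let f : CircleDeg1Lift := ⟨⟨fun t => t + partialSnd V (t, c), (hV.strictMono_fst c).monotone⟩,
    fun t => by simp only [hV.periodic.partialSnd t c]; ring⟩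
  have := continuous_partialSnd hV.contDiff
  exact f.continuous_iff_surjective.1
    (show Continuous fun t => t + partialSnd V (t, c) by fun_prop)

theorem exists_homeomorph_fst (hV : IsTwist V) :
    ∃ G : ℝ × ℝ ≃ₜ ℝ × ℝ, ∀ z, G z = (z.1 + partialSnd V z, z.2) := by
  have := continuous_partialSnd hV.contDiff
  obtain ⟨F, hF⟩ := exists_fiberwise_homeomorph (f := fun z => z.2 + partialSnd V (z.2, z.1))
    (by fun_prop) hV.strictMono_fst hV.surjective_fst
  exact ⟨((Homeomorph.prodComm ℝ ℝ).trans F).trans (Homeomorph.prodComm ℝ ℝ), fun z => by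
    simp [hF]⟩

theorem exists_homeomorph_snd (hV : IsTwist V) :
    ∃ H : ℝ × ℝ ≃ₜ ℝ × ℝ, ∀ z, H z = (z.1, z.2 + partialFst V z) := by
  have := continuous_partialFst hV.contDiff
  exact exists_fiberwise_homeomorph (f := fun z => z.2 + partialFst V z)
    (by fun_prop) hV.strictMono_snd hV.surjective

/-- The homeomorphism `(t, c) ↦ (t + ∂₂V(t, c), c)` of the plane. -/
noncomputable def homeoFst (hV : IsTwist V) : ℝ × ℝ ≃ₜ ℝ × ℝ := hV.exists_homeomorph_fst.choose

theorem homeoFst_apply (hV : IsTwist V) (z : ℝ × ℝ) :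
    hV.homeoFst z = (z.1 + partialSnd V z, z.2) := hV.exists_homeomorph_fst.choose_spec z

/-- The homeomorphism `(t, c) ↦ (t, c + ∂₁V(t, c))` of the plane. -/
noncomputable def homeoSnd (hV : IsTwist V) : ℝ × ℝ ≃ₜ ℝ × ℝ := hV.exists_homeomorph_snd.choose

theorem homeoSnd_apply (hV : IsTwist V) (z : ℝ × ℝ) :
    hV.homeoSnd z = (z.1, z.2 + partialFst V z) := hV.exists_homeomorph_snd.choose_spec z

theorem homeoFst_add_one (hV : IsTwist V) (t c : ℝ) :
    hV.homeoFst (t + 1, c) = ((hV.homeoFst (t, c)).1 + 1, (hV.homeoFst (t, c)).2) := by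
  simp only [homeoFst_apply, hV.periodic.partialSnd t c]
  ext <;> simp; ring

theorem homeoSnd_add_one (hV : IsTwist V) (t c : ℝ) :
    hV.homeoSnd (t + 1, c) = ((hV.homeoSnd (t, c)).1 + 1, (hV.homeoSnd (t, c)).2) := by
  simp only [homeoSnd_apply, hV.periodic.partialFst t c]

theorem exists_homeomorph (hV : IsTwist V) :
    ∃ f : Annulus ≃ₜ Annulus, ∀ z, f (cover z) = cover (hV.homeoSnd (hV.homeoFst.symm z)) :=
  exists_homeomorph_descend (hV.homeoFst.symm.trans hV.homeoSnd) fun t c => by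
    simp only [Homeomorph.trans_apply, symm_add_one hV.homeoFst_add_one, homeoSnd_add_one]

/-- The homeomorphism of the annulus generated by `V`. -/
noncomputable def homeo (hV : IsTwist V) : Annulus ≃ₜ Annulus := hV.exists_homeomorph.choose

theorem homeo_cover (hV : IsTwist V) (z : ℝ × ℝ) :
    hV.homeo (cover z) = cover (hV.homeoSnd (hV.homeoFst.symm z)) :=
  hV.exists_homeomorph.choose_spec z

theorem homeo_cover_homeoFst (hV : IsTwist V) (z : ℝ × ℝ) :
    hV.homeo (cover (hV.homeoFst z)) = cover (hV.homeoSnd z) := by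
  rw [homeo_cover, Homeomorph.symm_apply_apply]

theorem homeoFst_symm_snd (hV : IsTwist V) (z : ℝ × ℝ) : (hV.homeoFst.symm z).2 = z.2 := by
  conv_rhs => rw [← hV.homeoFst.apply_symm_apply z, homeoFst_apply]

theorem homeoFst_symm_fst_add (hV : IsTwist V) (z : ℝ × ℝ) :
    (hV.homeoFst.symm z).1 + partialSnd V (hV.homeoFst.symm z) = z.1 := by
  conv_rhs => rw [← hV.homeoFst.apply_symm_apply z, homeoFst_apply]

/-! ### Smooth generating functions -/

theorem partialFst_partialSnd_pos (hV : IsTwist V) (hs : ContDiff ℝ ∞ V) (z : ℝ × ℝ) :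
    0 < 1 + partialFst (partialSnd V) z := by
  obtain ⟨m, hm, h⟩ := hV.le_partialSnd |z.2|
  refine hm.trans_le (le_of_hasDerivAt_of_forall_gt
    ((hasDerivAt_id z.1).add
      (hasDerivAt_fst ((contDiff_partialSnd hs).of_le (by simp)) z.1 z.2)) (lt_add_one z.1)
    fun s hs _ => ?_)
  simpa using h z.2 le_rfl z.1 s hs.le

theorem partialSnd_partialFst_pos (hV : IsTwist V) (hs : ContDiff ℝ ∞ V) (z : ℝ × ℝ) :
    0 < 1 + partialSnd (partialFst V) z := by
  obtain ⟨m, hm, h⟩ := hV.le_partialFst (|z.2| + 1)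
  refine hm.trans_le (le_of_hasDerivAt_of_forall_gt
    ((hasDerivAt_id z.2).add
      (hasDerivAt_snd ((contDiff_partialFst hs).of_le (by simp)) z.1 z.2)) (lt_add_one z.2)
    fun s hs hs' => ?_)
  refine h z.1 z.2 s (by linarith) (abs_le.2 ⟨?_, ?_⟩) hs.le <;>
  linarith [neg_abs_le z.2, le_abs_self z.2]

theorem contDiff_homeoFst (hV : IsTwist V) (hs : ContDiff ℝ ∞ V) : ContDiff ℝ ∞ hV.homeoFst := by
  have := contDiff_partialSnd hs
  have e : ⇑hV.homeoFst = fun z => (z.1 + partialSnd V z, z.2) := funext hV.homeoFst_apply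
  rw [e]
  fun_prop

theorem contDiff_homeoSnd (hV : IsTwist V) (hs : ContDiff ℝ ∞ V) : ContDiff ℝ ∞ hV.homeoSnd := by
  have := contDiff_partialFst hs
  have e : ⇑hV.homeoSnd = fun z => (z.1, z.2 + partialFst V z) := funext hV.homeoSnd_apply
  rw [e]
  fun_prop

theorem contDiff_homeoFst_symm (hV : IsTwist V) (hs : ContDiff ℝ ∞ V) :
    ContDiff ℝ ∞ hV.homeoFst.symm := by
  refine contDiff_symm_of_injective_fderiv _ (hV.contDiff_homeoFst hs) fun z v hv => ?_
  have hd : HasFDerivAt (partialSnd V) (fderiv ℝ (partialSnd V) z) z :=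
    ((contDiff_partialSnd hs).differentiable (by simp) z).hasFDerivAt
  have e : ⇑hV.homeoFst = fun z => (z.1 + partialSnd V z, z.2) := funext hV.homeoFst_apply
  have hG : HasFDerivAt (fun z => (z.1 + partialSnd V z, z.2)) _ z :=
    (hasFDerivAt_fst.add hd).prodMk hasFDerivAt_snd
  rw [e, hG.fderiv] at hv
  obtain ⟨h1, h2⟩ := Prod.ext_iff.1 hv
  simp only [ContinuousLinearMap.prod_apply, add_apply,
    ContinuousLinearMap.coe_fst', ContinuousLinearMap.coe_snd', Prod.fst_zero,
    Prod.snd_zero, fderiv_apply_eq_partial] at h1 h2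
  have h3 : (1 + partialFst (partialSnd V) z) * v.1 = 0 := by rw [h2] at h1; linarith
  have h4 := (mul_eq_zero.1 h3).resolve_left (hV.partialFst_partialSnd_pos hs z).ne'
  exact Prod.ext h4 h2

theorem contDiff_homeoSnd_symm (hV : IsTwist V) (hs : ContDiff ℝ ∞ V) :
    ContDiff ℝ ∞ hV.homeoSnd.symm := by
  refine contDiff_symm_of_injective_fderiv _ (hV.contDiff_homeoSnd hs) fun z v hv => ?_
  have hd : HasFDerivAt (partialFst V) (fderiv ℝ (partialFst V) z) z :=
    ((contDiff_partialFst hs).differentiable (by simp) z).hasFDerivAt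
  have e : ⇑hV.homeoSnd = fun z => (z.1, z.2 + partialFst V z) := funext hV.homeoSnd_apply
  have hH : HasFDerivAt (fun z => (z.1, z.2 + partialFst V z)) _ z :=
    hasFDerivAt_fst.prodMk (hasFDerivAt_snd.add hd)
  rw [e, hH.fderiv] at hv
  obtain ⟨h1, h2⟩ := Prod.ext_iff.1 hv
  simp only [ContinuousLinearMap.prod_apply, add_apply,
    ContinuousLinearMap.coe_fst', ContinuousLinearMap.coe_snd', Prod.fst_zero,
    Prod.snd_zero, fderiv_apply_eq_partial] at h1 h2
  have h3 : (1 + partialSnd (partialFst V) z) * v.2 = 0 := by rw [h1] at h2; linarith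
  have h4 := (mul_eq_zero.1 h3).resolve_left (hV.partialSnd_partialFst_pos hs z).ne'
  exact Prod.ext h1 h4

/-- A smooth generating function generates an exact symplectic diffeomorphism. -/
theorem isExactSymplecticDiffeo_homeo (hV : IsTwist V) (hs : ContDiff ℝ ∞ V) :
    IsExactSymplecticDiffeo hV.homeo := by
  refine ⟨⟨hV.homeoFst ∘ hV.homeoSnd.symm,
    (hV.contDiff_homeoFst hs).comp (hV.contDiff_homeoSnd_symm hs), fun z => ?_⟩,
    hV.homeoSnd ∘ hV.homeoFst.symm,
    (hV.contDiff_homeoSnd hs).comp (hV.contDiff_homeoFst_symm hs),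
    fun z => (hV.homeo_cover z).symm, ?_⟩
  · rw [eq_comm, Homeomorph.symm_apply_eq, Function.comp_apply, homeo_cover_homeoFst,
      Homeomorph.apply_symm_apply]
  · have ha := hV.contDiff_homeoFst_symm hs
    set a : ℝ × ℝ → ℝ × ℝ := ⇑hV.homeoFst.symm with ha_def
    have ha2 : ∀ z, (a z).2 = z.2 := hV.homeoFst_symm_snd
    have ha1 : ∀ z, (a z).1 + partialSnd V (a z) = z.1 := hV.homeoFst_symm_fst_add
    -- The primitive of r dθ − c dx is V(θ,c) − c (x − θ): with x − θ = ∂₂V and r = c + ∂₁V, its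
    -- differential is ∂₁V dθ − c dx + c dθ.
    have hQp : IsPeriodic fun z => V (a z) - z.2 * (z.1 - (a z).1) := fun t c => by
      simp only [ha_def, symm_add_one hV.homeoFst_add_one]
      rw [hV.periodic]
      simp
    obtain ⟨S, hS⟩ := hQp.exists_eq_comp_cover
    refine ⟨S, ?_, fun z v => ?_⟩
    · rw [IsCn, hS]
      fun_prop
    · rw [hS]
      have hda : HasFDerivAt a (fderiv ℝ a z) z := (ha.differentiable (by simp) z).hasFDerivAt
      have hdV : HasFDerivAt V (fderiv ℝ V (a z)) (a z) :=
        (hs.differentiable (by simp) _).hasFDerivAt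
      have hF : HasFDerivAt (fun z => (hV.homeoSnd (a z)).1)
          ((ContinuousLinearMap.fst ℝ ℝ ℝ).comp (fderiv ℝ a z)) z := by
        simp only [homeoSnd_apply]
        exact hda.fst
      have hF' : (fderiv ℝ (hV.homeoSnd ∘ a) z v).1 = (fderiv ℝ a z v).1 := by
        have h0 : DifferentiableAt ℝ (hV.homeoSnd ∘ a) z :=
          ((hV.contDiff_homeoSnd hs).comp ha).differentiable (by simp) z
        exact congrArg (fun L : ℝ × ℝ →L[ℝ] ℝ => L v) (h0.hasFDerivAt.fst.unique hF)
      have h2 : (fderiv ℝ a z v).2 = v.2 := by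
        have h0 := hda.snd
        simp only [ha2] at h0
        exact congrArg (fun L : ℝ × ℝ →L[ℝ] ℝ => L v) (h0.unique hasFDerivAt_snd)
      have hQ := (hdV.comp z hda).sub ((hasFDerivAt_snd (𝕜 := ℝ) (p := z)).mul
        ((hasFDerivAt_fst (𝕜 := ℝ) (p := z)).sub hda.fst))
      have hQ' : fderiv ℝ (fun z => V (a z) - z.2 * (z.1 - (a z).1)) z v = _ :=
        congrArg (fun L : ℝ × ℝ →L[ℝ] ℝ => L v) hQ.fderiv
      rw [hQ', hF', Function.comp_apply, homeoSnd_apply, ha2]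
      simp only [sub_apply, add_apply,
        smul_apply, ContinuousLinearMap.comp_apply, Pi.sub_apply,
        ContinuousLinearMap.coe_fst', ContinuousLinearMap.coe_snd', smul_eq_mul,
        fderiv_apply_eq_partial (V := V), h2]
      have := ha1 z
      linear_combination (-v.2) * this

end IsTwist

end Annulus

namespace Annulus

/-! ### Approximation of the homeomorphism generated by a `C¹` function -/

theorem mollify_le (φ : ContDiffBump (0 : ℝ × ℝ)) {W : ℝ × ℝ → ℝ} (hW : Continuous W)
    {x : ℝ × ℝ} {a : ℝ} (h : ∀ y, dist y x < φ.rOut → W y ≤ a) : mollify φ W x ≤ a := by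
  have h1 := le_mollify φ hW.neg (x := x) (a := -a) fun y hy => neg_le_neg (h y hy)
  have h2 : mollify φ (-W) x = -mollify φ W x := by
    simp [mollify, integral_neg]
  rw [h2] at h1
  linarith

/-- Bump functions at the origin whose supports shrink to the origin. -/
noncomputable def shrinkingBump (n : ℕ) : ContDiffBump (0 : ℝ × ℝ) where
  rIn := 1 / (n + 1) / 2
  rOut := 1 / (n + 1)
  rIn_pos := by positivity
  rIn_lt_rOut := half_lt_self (by positivity)

theorem tendsto_shrinkingBump_rOut : Tendsto (fun n => (shrinkingBump n).rOut) atTop (𝓝 0) :=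
  tendsto_one_div_add_atTop_nhds_zero_nat

theorem eventually_dist_mollify_le {W : ℝ × ℝ → ℝ} (hp : IsPeriodic W) (hW : Continuous W)
    (R : ℝ) {ε : ℝ} (hε : 0 < ε) :
    ∀ᶠ n in atTop, ∀ z : ℝ × ℝ, |z.2| ≤ R → dist (mollify (shrinkingBump n) W z) (W z) ≤ ε := by
  obtain ⟨δ, hδ, h⟩ := hp.uniformContinuous_strip hW R hε
  filter_upwards [tendsto_shrinkingBump_rOut.eventually_lt_const hδ] with n hn z hz
  refine dist_mollify_le _ hW fun y hy => ?_
  rw [dist_comm]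
  exact (h z y hz (by rw [dist_comm]; exact hy.trans hn)).le

namespace IsTwist

variable {V : ℝ × ℝ → ℝ}

/-- The height at which c + ∂₁V reaches M is continuous and periodic in t. This makes the growth of
c + ∂₁V uniform in t, as averaging over balls requires. -/
theorem exists_bound_homeoSnd_symm (hV : IsTwist V) (M : ℝ) :
    ∃ R, ∀ t, |(hV.homeoSnd.symm (t, M)).2| ≤ R := by
  obtain ⟨R, hR⟩ := (isCompact_Icc (a := (0 : ℝ)) (b := 1)).exists_bound_of_continuousOn
    (f := fun t => (hV.homeoSnd.symm (t, M)).2)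
    (Continuous.continuousOn (by have := hV.homeoSnd.symm.continuous; fun_prop))
  refine ⟨R, fun t => ?_⟩
  have hp : IsPeriodic fun z => (hV.homeoSnd.symm z).2 := fun t c => by
    simp only [symm_add_one hV.homeoSnd_add_one]
  rw [← hp.add_int t M (-⌊t⌋)]
  refine hR _ ⟨?_, ?_⟩ <;> push_cast
  · linarith [Int.floor_le t]
  · linarith [Int.lt_floor_add_one t]

theorem homeoSnd_symm_fst (hV : IsTwist V) (z : ℝ × ℝ) : (hV.homeoSnd.symm z).1 = z.1 := by
  conv_rhs => rw [← hV.homeoSnd.apply_symm_apply z, homeoSnd_apply]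

theorem homeoSnd_symm_snd_add (hV : IsTwist V) (t M : ℝ) :
    (hV.homeoSnd.symm (t, M)).2 + partialFst V (t, (hV.homeoSnd.symm (t, M)).2) = M := by
  have h := hV.homeoSnd.apply_symm_apply (t, M)
  rw [homeoSnd_apply, Prod.ext_iff] at h
  have e : hV.homeoSnd.symm (t, M) = (t, (hV.homeoSnd.symm (t, M)).2) :=
    Prod.ext (hV.homeoSnd_symm_fst _) rfl
  have h2 := h.2
  rw [e] at h2
  exact h2

theorem exists_forall_le_add_partialFst (hV : IsTwist V) (M : ℝ) :
    ∃ R, ∀ t c, R ≤ c → M ≤ c + partialFst V (t, c) := by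
  obtain ⟨R, hR⟩ := hV.exists_bound_homeoSnd_symm M
  refine ⟨R, fun t c hc => ?_⟩
  conv_lhs => rw [← hV.homeoSnd_symm_snd_add t M]
  exact (hV.strictMono_snd t).monotone (((le_abs_self _).trans (hR t)).trans hc)

theorem exists_forall_add_partialFst_le (hV : IsTwist V) (M : ℝ) :
    ∃ R, ∀ t c, c ≤ R → c + partialFst V (t, c) ≤ M := by
  obtain ⟨R, hR⟩ := hV.exists_bound_homeoSnd_symm M
  refine ⟨-R, fun t c hc => ?_⟩
  conv_rhs => rw [← hV.homeoSnd_symm_snd_add t M]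
  exact (hV.strictMono_snd t).monotone (hc.trans (abs_le.1 (hR t)).1)

theorem mollify (hV : IsTwist V) (φ : ContDiffBump (0 : ℝ × ℝ)) : IsTwist (mollify φ V) where
  contDiff := (contDiff_mollify φ hV.contDiff.continuous).of_le (by simp)
  periodic := hV.periodic.mollify φ
  rectGE R := by
    obtain ⟨m, hm, h⟩ := hV.rectGE (R + φ.rOut)
    refine ⟨m, hm, h.mollify φ hV.contDiff.continuous fun c hc d hd => ?_⟩
    rw [abs_lt] at hd
    exact ⟨by linarith [hc.1], by linarith [hc.2]⟩
  surjective t := by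
    have hc := continuous_partialFst hV.contDiff
    have hc' : Continuous (partialFst (Annulus.mollify φ V)) :=
      continuous_partialFst ((contDiff_mollify φ hV.contDiff.continuous).of_le (by simp))
    refine Continuous.surjective (by fun_prop) (tendsto_atTop.2 fun b => ?_)
      (tendsto_atBot.2 fun b => ?_)
    -- The margin `φ.rOut` added to `b` absorbs the variation of the height over the averaging ball;
    -- the one added to `R` keeps that ball above `R`.
    · obtain ⟨R, hR⟩ := hV.exists_forall_le_add_partialFst (b + φ.rOut)
      filter_upwards [eventually_ge_atTop (R + φ.rOut)] with c hcR
      have : b - c ≤ partialFst (Annulus.mollify φ V) (t, c) := by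
        rw [partialFst_mollify φ hV.contDiff]
        refine le_mollify φ hc fun y hy => ?_
        have hy2 : |y.2 - c| < φ.rOut := (le_max_right _ _).trans_lt hy
        rw [abs_lt] at hy2
        have := hR y.1 y.2 (by linarith)
        linarith
      linarith
    · obtain ⟨R, hR⟩ := hV.exists_forall_add_partialFst_le (b - φ.rOut)
      filter_upwards [eventually_le_atBot (R - φ.rOut)] with c hcR
      have : partialFst (Annulus.mollify φ V) (t, c) ≤ b - c := by
        rw [partialFst_mollify φ hV.contDiff]
        refine mollify_le φ hc fun y hy => ?_
        have hy2 : |y.2 - c| < φ.rOut := (le_max_right _ _).trans_lt hy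
        rw [abs_lt] at hy2
        have := hR y.1 y.2 (by linarith)
        linarith
      linarith

/-- The homeomorphism generated by a `C¹` function is exact symplectic. -/
theorem isExactSymplecticHomeo_homeo (hV : IsTwist V) : IsExactSymplecticHomeo hV.homeo := by
  refine ⟨fun n => (hV.mollify (shrinkingBump n)).homeo, fun n =>
    (hV.mollify _).isExactSymplecticDiffeo_homeo (contDiff_mollify _ hV.contDiff.continuous), ?_⟩
  rw [ContinuousMap.tendsto_iff_forall_isCompact_tendstoUniformlyOn]
  intro K hK
  rw [Metric.tendstoUniformlyOn_iff]
  intro ε hε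
  obtain ⟨R, hR⟩ := hK.exists_bound_of_continuousOn continuous_snd.continuousOn
  obtain ⟨m, hm, hmon⟩ := hV.le_partialSnd R
  have hc1 := continuous_partialFst hV.contDiff
  have hc2 := continuous_partialSnd hV.contDiff
  obtain ⟨δ, hδ, huc⟩ := hV.periodic.partialFst.uniformContinuous_strip hc1 R (half_pos hε)
  -- Tolerance on the first coordinate: δ / 2 serves the uniform continuity of ∂₁V, ε / 2 the
  -- distance itself.
  set η := min (δ / 2) (ε / 2) with hη
  have hη0 : 0 < η := lt_min (half_pos hδ) (half_pos hε)
  filter_upwards [eventually_dist_mollify_le hV.periodic.partialSnd hc2 R (mul_pos hm hη0),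
    eventually_dist_mollify_le hV.periodic.partialFst hc1 R (half_pos hε)] with n h2 h1 p hp
  obtain ⟨z, rfl⟩ := surjective_cover p
  have hz : |z.2| ≤ R := hR _ hp
  have hVn := hV.mollify (shrinkingBump n)
  change dist (hV.homeo (cover z)) (hVn.homeo (cover z)) < ε
  rw [homeo_cover, homeo_cover]
  refine (dist_cover_le _ _).trans_lt ?_
  have e1 := hV.homeoFst_symm_fst_add z
  have e2 := hVn.homeoFst_symm_fst_add z
  have hG : hV.homeoFst.symm z = ((hV.homeoFst.symm z).1, z.2) :=
    Prod.ext rfl (hV.homeoFst_symm_snd z)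
  have hGn : hVn.homeoFst.symm z = ((hVn.homeoFst.symm z).1, z.2) :=
    Prod.ext rfl (hVn.homeoFst_symm_snd z)
  rw [homeoSnd_apply, homeoSnd_apply]
  generalize (hV.homeoFst.symm z).1 = t at *
  generalize (hVn.homeoFst.symm z).1 = s at *
  rw [hG] at e1 ⊢
  rw [hGn] at e2 ⊢
  rw [partialSnd_mollify _ hV.contDiff] at e2
  rw [partialFst_mollify _ hV.contDiff]
  have hd2 := h2 (s, z.2) hz
  have hd1 := h1 (s, z.2) hz
  rw [Real.dist_eq, abs_le] at hd2
  -- Both t + ∂₂V(t) and s + ∂₂Vₙ(s) equal `z.1`, so m |t − s| is at most the error of ∂₂Vₙ at s,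
  -- itself at most m η.
  have hst : |t - s| ≤ η := by
    refine le_of_mul_le_mul_left ?_ hm
    rcases le_total t s with hts | hts
    · rw [abs_of_nonpos (by linarith)]
      have := hmon z.2 hz t s hts
      linarith
    · rw [abs_of_nonneg (by linarith)]
      have := hmon z.2 hz s t hts
      linarith
  have huc' := huc (t, z.2) (s, z.2) hz (by
    rw [Prod.dist_eq, dist_self, max_eq_left dist_nonneg, Real.dist_eq]
    exact hst.trans_lt ((min_le_left _ _).trans_lt (half_lt_self hδ)))
  rw [Prod.dist_eq, max_lt_iff]
  constructor
  · exact hst.trans_lt ((min_le_right _ _).trans_lt (half_lt_self hε))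
  · simp only [Real.dist_eq, abs_le, abs_lt] at huc' hd1 ⊢
    constructor <;> linarith

end IsTwist

end Annulus

namespace Annulus

/-! ### Partial derivatives on the annulus and on the plane -/

section Lift

variable {u : Annulus → ℝ}

theorem dTheta_cover (hu1 : IsCn 1 u) (z : ℝ × ℝ) :
    dTheta u (cover z) = partialFst (u ∘ cover) z := by
  have h : HasDerivAt (fun t => (u ∘ cover) (z.1 + t, z.2)) (partialFst (u ∘ cover) z) 0 :=
    HasDerivAt.comp_const_add z.1 0 (by simpa using hasDerivAt_fst hu1 z.1 z.2)
  exact h.deriv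

theorem dC_cover (hu1 : IsCn 1 u) (z : ℝ × ℝ) : dC u (cover z) = partialSnd (u ∘ cover) z :=
  (hasDerivAt_snd hu1 z.1 z.2).deriv

theorem hasMixedDerivAt_cover (hu1 : IsCn 1 u) (d : ℝ) (z : ℝ × ℝ) :
    HasMixedDerivAt u d (cover z) ↔
      HasDerivAt (fun t => partialSnd (u ∘ cover) (t, z.2)) d z.1 := by
  have e : (fun t : ℝ => dC u ((cover z).1 + (t : UnitAddCircle), (cover z).2)) =
      fun t => partialSnd (u ∘ cover) (z.1 + t, z.2) :=
    funext fun t => dC_cover hu1 (z.1 + t, z.2)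
  rw [HasMixedDerivAt, e]
  constructor
  · intro h
    have := HasDerivAt.comp_const_add (-z.1) z.1 (by simpa using h)
    simpa using this
  · intro h
    exact HasDerivAt.comp_const_add z.1 0 (by simpa using h)

theorem continuous_of_comp_cover {f : Annulus → ℝ} (h : Continuous (f ∘ cover)) : Continuous f :=
  isOpenQuotientMap_cover.isQuotientMap.continuous_iff.2 h

theorem continuous_dTheta (hu1 : IsCn 1 u) : Continuous (dTheta u) :=
  continuous_of_comp_cover ((continuous_partialFst hu1).congr fun z => (dTheta_cover hu1 z).symm)

theorem continuous_dC (hu1 : IsCn 1 u) : Continuous (dC u) :=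
  continuous_of_comp_cover ((continuous_partialSnd hu1).congr fun z => (dC_cover hu1 z).symm)

/-- Periodicity kills the integral of ∂u/∂θ over a period. Thus c is determined by its leaf, as the
mean height. -/
theorem integral_add_dTheta (hu1 : IsCn 1 u) (c : ℝ) :
    ∫ t in (0 : ℝ)..1, (c + dTheta u ((t : UnitAddCircle), c)) = c := by
  have e : ∀ t : ℝ, dTheta u ((t : UnitAddCircle), c) = partialFst (u ∘ cover) (t, c) :=
    fun t => dTheta_cover hu1 (t, c)
  have hc := continuous_partialFst hu1
  have hi : IntervalIntegrable (fun t => partialFst (u ∘ cover) (t, c)) volume 0 1 :=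
    Continuous.intervalIntegrable (by fun_prop) _ _
  simp only [e]
  rw [intervalIntegral.integral_add intervalIntegrable_const hi,
    intervalIntegral.integral_eq_sub_of_hasDerivAt (fun t _ => hasDerivAt_fst hu1 t c) hi]
  have := isPeriodic_comp_cover u 0 c
  rw [zero_add] at this
  rw [this]
  simp

end Lift

/-! ### Parametrizations of foliations -/

section Foliation

variable {𝓕 : Set (Set Annulus)} {u : Annulus → ℝ} {η : ℝ → UnitAddCircle → ℝ}
  {Ψ : Annulus ≃ₜ Annulus}

theorem graph_injective : Function.Injective graph := by
  intro η η' h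
  funext θ
  have : (θ, η θ) ∈ graph η' := h ▸ rfl
  exact this

theorem Parametrizes.continuous (h : Parametrizes η Ψ 𝓕) :
    Continuous fun p : Annulus => η p.2 p.1 := by
  have e : (fun p : Annulus => η p.2 p.1) = fun p => (Ψ p).2 :=
    funext fun p => (congrArg Prod.snd (h.1 p.1 p.2)).symm
  rw [e]
  exact continuous_snd.comp Ψ.continuous

theorem Parametrizes.injective (h : Parametrizes η Ψ 𝓕) (θ : UnitAddCircle) :
    Function.Injective fun a => η a θ := by
  intro a b hab
  have : Ψ (θ, a) = Ψ (θ, b) := by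
    rw [h.1, h.1]
    exact Prod.ext rfl hab
  exact congrArg Prod.snd (Ψ.injective this)

theorem Parametrizes.surjective (h : Parametrizes η Ψ 𝓕) (θ : UnitAddCircle) :
    Function.Surjective fun a => η a θ := by
  intro r
  obtain ⟨⟨θ', a⟩, ha⟩ := Ψ.surjective (θ, r)
  rw [h.1, Prod.ext_iff] at ha
  obtain ⟨rfl, ha⟩ := ha
  exact ⟨a, ha⟩

/-- The leaves of a foliation are ordered the same way on all fibres. -/
theorem Parametrizes.strictMono_or_strictAnti (h : Parametrizes η Ψ 𝓕) :
    (∀ θ, StrictMono fun a => η a θ) ∨ ∀ θ, StrictAnti fun a => η a θ := by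
  have hc := h.continuous
  have hθ : ∀ θ, StrictMono (fun a => η a θ) ∨ StrictAnti fun a => η a θ := fun θ =>
    (hc.comp (by fun_prop : Continuous fun a : ℝ => ((θ, a) : Annulus))).strictMono_of_inj
      (h.injective θ)
  by_contra! hcon
  obtain ⟨⟨θ₁, h1⟩, θ₂, h2⟩ := hcon
  have h1' := (hθ θ₁).resolve_left h1
  have h2' := (hθ θ₂).resolve_right h2
  have hd : Continuous fun θ => η 1 θ - η 0 θ :=
    (hc.comp (by fun_prop : Continuous fun θ : UnitAddCircle => ((θ, 1) : Annulus))).sub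
      (hc.comp (by fun_prop : Continuous fun θ : UnitAddCircle => ((θ, 0) : Annulus)))
  -- With opposite orders on two fibres, the leaves of parameters 0 and 1 would cross, the circle
  -- being connected.
  obtain ⟨θ, hθ0⟩ := mem_range_of_exists_le_of_exists_ge hd (c := 0)
    ⟨θ₁, sub_nonpos.2 (h1' one_pos).le⟩ ⟨θ₂, sub_nonneg.2 (h2' one_pos).le⟩
  exact one_ne_zero (h.injective θ (sub_eq_zero.1 hθ0))

theorem Parametrizes.continuous_coe (h : Parametrizes η Ψ 𝓕) (a : ℝ) :
    Continuous fun t : ℝ => η a (t : UnitAddCircle) :=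
  h.continuous.comp ((AddCircle.continuous_mk' 1).prodMk continuous_const)

/-- Leaves are ordered the same way over the whole circle, so their means are strictly ordered too.
-/
theorem Parametrizes.integral_injective (h : Parametrizes η Ψ 𝓕) :
    Function.Injective fun a => ∫ t in (0 : ℝ)..1, η a (t : UnitAddCircle) := by
  have hi := fun a => (h.continuous_coe a).intervalIntegrable (μ := volume) 0 1
  rcases h.strictMono_or_strictAnti with hm | hm
  · refine StrictMono.injective fun a b hab => ?_
    exact intervalIntegral.integral_lt_integral_of_continuousOn_of_le_of_exists_lt one_pos
      (h.continuous_coe a).continuousOn (h.continuous_coe b).continuousOn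
      (fun t _ => (hm t hab).le) ⟨0, by simp, hm _ hab⟩
  · refine StrictAnti.injective fun a b hab => ?_
    exact intervalIntegral.integral_lt_integral_of_continuousOn_of_le_of_exists_lt one_pos
      (h.continuous_coe b).continuousOn (h.continuous_coe a).continuousOn
      (fun t _ => (hm t hab).le) ⟨0, by simp, hm _ hab⟩

/-- The leaves can be parametrized by the `c` of the generating function. -/
theorem Parametrizes.exists_reparametrization (h : Parametrizes η Ψ 𝓕)
    (hu : IsFoliationGeneratingFunction u 𝓕) (hu1 : IsCn 1 u) :
    ∃ A : ℝ ≃ₜ ℝ, Parametrizes (fun c θ => c + dTheta u (θ, c))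
      (((Homeomorph.refl UnitAddCircle).prodCongr A).trans Ψ) 𝓕 := by
  have hleaf : ∀ c, ∃ a, ∀ θ, η a θ = c + dTheta u (θ, c) := fun c => by
    have := hu.leaf c
    rw [h.2] at this
    obtain ⟨a, ha⟩ := this
    exact ⟨a, congrFun (graph_injective ha)⟩
  choose A hA using hleaf
  have hAΨ : ∀ c, A c = (Ψ.symm (0, c + dTheta u (0, c))).2 := fun c => by
    rw [← hA, ← h.1, Homeomorph.symm_apply_apply]
  have hAc : Continuous A := by
    rw [funext hAΨ]
    have := continuous_dTheta hu1
    have := Ψ.symm.continuous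
    fun_prop
  have hmA : ∀ c, ∫ t in (0 : ℝ)..1, η (A c) (t : UnitAddCircle) = c := fun c => by
    simp only [hA]
    exact integral_add_dTheta hu1 c
  -- The inverse of A sends a leaf to its mean, which is continuous in the parameter.
  refine ⟨⟨⟨A, fun a => ∫ t in (0 : ℝ)..1, η a (t : UnitAddCircle), hmA, fun a =>
    h.integral_injective (hmA _)⟩, hAc, ?_⟩, fun θ c => ?_, ?_⟩
  · refine intervalIntegral.continuous_parametric_intervalIntegral_of_continuous' ?_ 0 1
    exact h.continuous.comp (((AddCircle.continuous_mk' 1).comp continuous_snd).prodMk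
      continuous_fst)
  · exact (h.1 θ (A c)).trans (Prod.ext rfl (hA c θ))
  · rw [h.2]
    have hs : Function.Surjective A := fun a => ⟨_, h.integral_injective (hmA _)⟩
    rw [← hs.range_comp]
    congr 1
    funext c
    exact congrArg graph (funext (hA c))

/-- The decreasing case would make the means decrease, but the mean of the leaf of c is c. -/
theorem Parametrizes.strictMono (h : Parametrizes (fun c θ => c + dTheta u (θ, c)) Ψ 𝓕)
    (hu1 : IsCn 1 u) (θ : UnitAddCircle) : StrictMono fun c => c + dTheta u (θ, c) := by
  refine h.strictMono_or_strictAnti.resolve_right (fun hm => ?_) θ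
  have := intervalIntegral.integral_mono (a := (0 : ℝ)) (b := 1) (μ := volume) zero_le_one
    ((h.continuous_coe 1).intervalIntegrable _ _) ((h.continuous_coe 0).intervalIntegrable _ _)
    fun t => (hm t one_pos).le
  rw [integral_add_dTheta hu1, integral_add_dTheta hu1] at this
  linarith

/-- A locally biLipschitz parametrization is biLipschitz on fibres, locally uniformly. -/
theorem Parametrizes.exists_fiber_bound (h : Parametrizes η Ψ 𝓕) (hL : LocallyBiLipschitz Ψ)
    (a₀ : ℝ) : ∃ K : ℝ, 1 ≤ K ∧ ∃ J ∈ 𝓝 a₀, ∀ θ, ∀ a ∈ J, ∀ b ∈ J,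
      |η a θ - η b θ| ≤ K * |a - b| ∧ |a - b| ≤ K * |η a θ - η b θ| := by
  have hd : ∀ θ a b, dist (Ψ (θ, a)) (Ψ (θ, b)) = |η a θ - η b θ| := fun θ a b => by
    rw [h.1, h.1, Prod.dist_eq, dist_self, max_eq_right dist_nonneg, Real.dist_eq]
  have hd' : ∀ (θ : UnitAddCircle) (a b : ℝ), dist ((θ, a) : Annulus) (θ, b) = |a - b| :=
    fun θ a b => by
      rw [Prod.dist_eq, dist_self, max_eq_right dist_nonneg, Real.dist_eq]
  suffices H : ∃ K : ℝ, 1 ≤ K ∧ ∃ J ∈ 𝓝 a₀, ∀ θ ∈ (Set.univ : Set UnitAddCircle),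
      ∀ a ∈ J, ∀ b ∈ J, |η a θ - η b θ| ≤ K * |a - b| ∧ |a - b| ≤ K * |η a θ - η b θ| by
    simpa using H
  -- The biLipschitz neighbourhoods depend on θ; compactness of the circle gives one K and one J for
  -- all fibres.
  refine isCompact_univ.induction_on (p := fun s => ∃ K : ℝ, 1 ≤ K ∧ ∃ J ∈ 𝓝 a₀, ∀ θ ∈ s,
    ∀ a ∈ J, ∀ b ∈ J, |η a θ - η b θ| ≤ K * |a - b| ∧ |a - b| ≤ K * |η a θ - η b θ|)
    ⟨1, le_rfl, Set.univ, univ_mem, by simp⟩ ?_ ?_ ?_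
  · rintro s t hst ⟨K, hK, J, hJ, H⟩
    exact ⟨K, hK, J, hJ, fun θ hθ => H θ (hst hθ)⟩
  · rintro s t ⟨K, hK, J, hJ, H⟩ ⟨K', hK', J', hJ', H'⟩
    refine ⟨max K K', le_max_of_le_left hK, J ∩ J', inter_mem hJ hJ', ?_⟩
    rintro θ (hθ | hθ) a ha b hb
    · obtain ⟨h1, h2⟩ := H θ hθ a ha.1 b hb.1
      exact ⟨h1.trans (mul_le_mul_of_nonneg_right (le_max_left _ _) (abs_nonneg _)),
        h2.trans (mul_le_mul_of_nonneg_right (le_max_left _ _) (abs_nonneg _))⟩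
    · obtain ⟨h1, h2⟩ := H' θ hθ a ha.2 b hb.2
      exact ⟨h1.trans (mul_le_mul_of_nonneg_right (le_max_right _ _) (abs_nonneg _)),
        h2.trans (mul_le_mul_of_nonneg_right (le_max_right _ _) (abs_nonneg _))⟩
  · intro θ₀ _
    obtain ⟨K, W, hW, H⟩ := hL (θ₀, a₀)
    rw [nhds_prod_eq, mem_prod_iff] at hW
    obtain ⟨S, hS, J, hJ, hSJ⟩ := hW
    refine ⟨S, mem_nhdsWithin_of_mem_nhds hS, max K 1, le_max_right _ _, J, hJ,
      fun θ hθ a ha b hb => ?_⟩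
    obtain ⟨h1, h2⟩ := H (θ, a) (hSJ ⟨hθ, ha⟩) (θ, b) (hSJ ⟨hθ, hb⟩)
    rw [hd, hd'] at h1 h2
    exact ⟨h1.trans (mul_le_mul_of_nonneg_right (le_max_left _ _) (abs_nonneg _)),
      h2.trans (mul_le_mul_of_nonneg_right (le_max_left _ _) (abs_nonneg _))⟩

theorem LocallyBiLipschitz.locallyLipschitz {f : Annulus → Annulus} (hf : LocallyBiLipschitz f) :
    LocallyLipschitz f := fun p => by
  obtain ⟨K, W, hW, H⟩ := hf p
  exact ⟨K, W, hW, LipschitzOnWith.of_dist_le_mul fun x hx y hy => (H x hx y hy).1⟩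

/-- In a Lipschitz foliation, the parametrization by the `c` of the generating function is
biLipschitz on fibres, and the change of parameter is Lipschitz, locally uniformly. -/
theorem exists_fiber_bound_of_reparametrization {A : ℝ ≃ₜ ℝ} (h : Parametrizes η Ψ 𝓕)
    (hL : LocallyBiLipschitz Ψ) (hu1 : IsCn 1 u)
    (hA : Parametrizes (fun c θ => c + dTheta u (θ, c))
      (((Homeomorph.refl UnitAddCircle).prodCongr A).trans Ψ) 𝓕) (c₀ : ℝ) :
    ∃ K : ℝ, 1 ≤ K ∧ ∃ J ∈ 𝓝 c₀, ∀ c ∈ J, ∀ c' ∈ J, c ≤ c' →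
      |A c' - A c| ≤ K * (c' - c) ∧ ∀ θ,
        c' + dTheta u (θ, c') - (c + dTheta u (θ, c)) ≤ K ^ 2 * (c' - c) ∧
        c' - c ≤ K ^ 2 * (c' + dTheta u (θ, c') - (c + dTheta u (θ, c))) := by
  obtain ⟨K, hK, J, hJ, H⟩ := h.exists_fiber_bound hL (A c₀)
  have hK0 : 0 < K := by linarith
  have hη : ∀ c θ, η (A c) θ = c + dTheta u (θ, c) := fun c θ =>
    congrArg Prod.snd ((h.1 θ (A c)).symm.trans (hA.1 θ c))
  refine ⟨K, hK, A ⁻¹' J, A.continuous.continuousAt.preimage_mem_nhds hJ,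
    fun c hc c' hc' hcc => ?_⟩
  -- Every gap D θ is comparable to |A c' − A c| with ratio K, and so is the mean c' − c of D.
  -- Eliminating |A c' − A c| costs K².
  set D : UnitAddCircle → ℝ := fun θ => c' + dTheta u (θ, c') - (c + dTheta u (θ, c)) with hD
  have hD0 : ∀ θ, |η (A c') θ - η (A c) θ| = D θ := fun θ => by
    rw [hη, hη, abs_of_nonneg (sub_nonneg.2 ((hA.strictMono hu1 θ).monotone hcc))]
  have h1 : ∀ θ, D θ ≤ K * |A c' - A c| := fun θ => hD0 θ ▸ (H θ _ hc' _ hc).1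
  have h2 : ∀ θ, |A c' - A c| ≤ K * D θ := fun θ => hD0 θ ▸ (H θ _ hc' _ hc).2
  have hDc : Continuous fun t : ℝ => D t := (hA.continuous_coe c').sub (hA.continuous_coe c)
  have hi : ∫ t in (0 : ℝ)..1, D t = c' - c := by
    simp only [hD]
    rw [intervalIntegral.integral_sub ((hA.continuous_coe c').intervalIntegrable _ _)
      ((hA.continuous_coe c).intervalIntegrable _ _), integral_add_dTheta hu1,
      integral_add_dTheta hu1]
  have h3 : c' - c ≤ K * |A c' - A c| := by
    have := intervalIntegral.integral_mono (a := (0 : ℝ)) (b := 1) (μ := volume) zero_le_one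
      (hDc.intervalIntegrable _ _) intervalIntegrable_const fun t => h1 t
    rw [hi] at this
    simpa using this
  have h4 : |A c' - A c| ≤ K * (c' - c) := by
    have := intervalIntegral.integral_mono (a := (0 : ℝ)) (b := 1) (μ := volume) zero_le_one
      intervalIntegrable_const ((hDc.const_mul K).intervalIntegrable _ _) fun t => h2 t
    rw [intervalIntegral.integral_const_mul, hi] at this
    simpa using this
  refine ⟨h4, fun θ => ⟨?_, ?_⟩⟩
  · calc D θ ≤ K * |A c' - A c| := h1 θ
      _ ≤ K * (K * (c' - c)) := mul_le_mul_of_nonneg_left h4 hK0.le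
      _ = K ^ 2 * (c' - c) := by ring
  · calc c' - c ≤ K * |A c' - A c| := h3
      _ ≤ K * (K * D θ) := mul_le_mul_of_nonneg_left (h2 θ) hK0.le
      _ = K ^ 2 * D θ := by ring

theorem locallyLipschitz_dTheta {A : ℝ ≃ₜ ℝ} (h : Parametrizes η Ψ 𝓕)
    (hL : LocallyBiLipschitz Ψ) (hu1 : IsCn 1 u)
    (hA : Parametrizes (fun c θ => c + dTheta u (θ, c))
      (((Homeomorph.refl UnitAddCircle).prodCongr A).trans Ψ) 𝓕) :
    LocallyLipschitz (dTheta u) := by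
  have hAL : LocallyLipschitz A := fun c₀ => by
    obtain ⟨K, hK, J, hJ, H⟩ := exists_fiber_bound_of_reparametrization h hL hu1 hA c₀
    refine ⟨K.toNNReal, J, hJ, LipschitzOnWith.of_dist_le_mul fun x hx y hy => ?_⟩
    rw [Real.dist_eq, Real.dist_eq, Real.coe_toNNReal K (by linarith)]
    rcases le_total x y with hxy | hxy
    · rw [abs_sub_comm, abs_sub_comm x, abs_of_nonneg (sub_nonneg.2 hxy)]
      exact (H x hx y hy hxy).1
    · rw [abs_of_nonneg (sub_nonneg.2 hxy)]
      exact (H y hy x hx hxy).1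
  have h1 : LocallyLipschitz fun p : Annulus => (p.1, A p.2) :=
    LocallyLipschitz.prodMk LipschitzWith.prod_fst.locallyLipschitz
      (hAL.comp LipschitzWith.prod_snd.locallyLipschitz)
  have h2 : LocallyLipschitz fun p : Annulus => (Ψ (p.1, A p.2)).2 :=
    LipschitzWith.prod_snd.locallyLipschitz.comp (hL.locallyLipschitz.comp h1)
  have h3 : LocallyLipschitz fun p : Annulus => ((Ψ (p.1, A p.2)).2, p.2) :=
    h2.prodMk LipschitzWith.prod_snd.locallyLipschitz
  have h4 : LocallyLipschitz fun q : ℝ × ℝ => q.1 - q.2 :=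
    (LipschitzWith.prod_fst.sub LipschitzWith.prod_snd).locallyLipschitz
  have e : dTheta u = fun p : Annulus => (Ψ (p.1, A p.2)).2 - p.2 := funext fun p => by
    have := congrArg Prod.snd (hA.1 p.1 p.2)
    rw [show (Ψ (p.1, A p.2)).2 = p.2 + dTheta u p from this]
    ring
  rw [e]
  exact h4.comp h3

end Foliation

end Annulus

namespace Annulus

/-! ### Slope bounds for `∂u/∂c` in the variable `θ` -/

/-- The function `g` has all its slopes between `k` and `k'`. -/
def SlopesBetween (k k' : ℝ) (g : ℝ → ℝ) : Prop :=
  ∀ t₁ t₂, t₁ ≤ t₂ → k * (t₂ - t₁) ≤ g t₂ - g t₁ ∧ g t₂ - g t₁ ≤ k' * (t₂ - t₁)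

theorem SlopesBetween.mono {k k' l l' : ℝ} {g : ℝ → ℝ} (h : SlopesBetween k k' g) (hl : l ≤ k)
    (hl' : k' ≤ l') : SlopesBetween l l' g := fun t₁ t₂ ht =>
  ⟨(mul_le_mul_of_nonneg_right hl (sub_nonneg.2 ht)).trans (h t₁ t₂ ht).1,
    (h t₁ t₂ ht).2.trans (mul_le_mul_of_nonneg_right hl' (sub_nonneg.2 ht))⟩

theorem SlopesBetween.abs_sub_le {k k' : ℝ} {g : ℝ → ℝ} (h : SlopesBetween k k' g) (x y : ℝ) :
    |g x - g y| ≤ max |k| |k'| * |x - y| := by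
  wlog hxy : y ≤ x generalizing x y
  · rw [abs_sub_comm, abs_sub_comm x]
    exact this y x (le_of_not_ge hxy)
  obtain ⟨h1, h2⟩ := h y x hxy
  have h0 : 0 ≤ x - y := sub_nonneg.2 hxy
  rw [abs_of_nonneg h0, abs_le]
  constructor
  · have := mul_le_mul_of_nonneg_right ((neg_abs_le k).trans' (neg_le_neg (le_max_left _ |k'|))) h0
    linarith
  · have := mul_le_mul_of_nonneg_right ((le_abs_self k').trans (le_max_right |k| _)) h0
    linarith

theorem SlopesBetween.lipschitzWith {k k' : ℝ} {g : ℝ → ℝ} (h : SlopesBetween k k' g) :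
    LipschitzWith (max |k| |k'|).toNNReal g :=
  LipschitzWith.of_dist_le_mul fun x y => by
    rw [Real.coe_toNNReal _ (le_max_of_le_left (abs_nonneg k))]
    exact h.abs_sub_le x y

theorem SlopesBetween.hasDerivAt_mem {k k' d x : ℝ} {g : ℝ → ℝ} (h : SlopesBetween k k' g)
    (hd : HasDerivAt g d x) : k ≤ d ∧ d ≤ k' := by
  refine ⟨le_of_hasDerivAt_of_forall_gt hd (lt_add_one x) fun s hs _ => (h x s hs.le).1, ?_⟩
  refine neg_le_neg_iff.1 (le_of_hasDerivAt_of_forall_gt hd.neg (lt_add_one x) fun s hs _ => ?_)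
  have := (h x s hs.le).2
  simp only [Pi.neg_apply]
  linarith

/-- A Lipschitz function whose derivative is at least `k` almost everywhere has slopes at least
`k`. -/
theorem _root_.LipschitzWith.mul_sub_le_of_ae_le_deriv {g : ℝ → ℝ} {L : ℝ≥0} {k : ℝ}
    (hg : LipschitzWith L g) (h : ∀ᵐ t, k ≤ deriv g t) {t₁ t₂ : ℝ} (ht : t₁ ≤ t₂) :
    k * (t₂ - t₁) ≤ g t₂ - g t₁ := by
  have hac : AbsolutelyContinuousOnInterval g t₁ t₂ :=
    (hg.lipschitzOnWith).absolutelyContinuousOnInterval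
  rw [← hac.integral_deriv_eq_sub]
  have := intervalIntegral.integral_mono_ae ht
    (intervalIntegrable_const (μ := volume) (c := k)) hac.intervalIntegrable_deriv h
  rw [intervalIntegral.integral_const, smul_eq_mul] at this
  linarith

/-- Over every compact set of `c`, the slopes of `θ ↦ θ + ∂u/∂c(θ, c)` are bounded, and bounded
away from zero. -/
def HasUniformSlopes (u : Annulus → ℝ) : Prop :=
  ∀ C : Set ℝ, IsCompact C → ∃ m > 0, ∃ M : ℝ, ∀ c ∈ C,
    SlopesBetween (m - 1) (M - 1) fun t => partialSnd (u ∘ cover) (t, c)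

section Foliation

variable {𝓕 : Set (Set Annulus)} {u : Annulus → ℝ} {Ψ : Annulus ≃ₜ Annulus}

/-- Gap bounds between leaves are slope bounds for c ↦ c + ∂u/∂θ, and rectangles turn them into
slope bounds K⁻² − 1 and K² − 1 for θ ↦ ∂u/∂c. The upper one is a lower one for −u. -/
theorem IsLipschitzFoliation.hasUniformSlopes (h : IsLipschitzFoliation 𝓕)
    (hu : IsFoliationGeneratingFunction u 𝓕) (hu1 : IsCn 1 u) : HasUniformSlopes u := by
  obtain ⟨η, Ψ, hp, hL⟩ := h
  obtain ⟨A, hA⟩ := hp.exists_reparametrization hu hu1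
  intro C hC
  refine hC.induction_on (p := fun C => ∃ m > 0, ∃ M : ℝ, ∀ c ∈ C,
    SlopesBetween (m - 1) (M - 1) fun t => partialSnd (u ∘ cover) (t, c))
    ⟨1, one_pos, 0, by simp⟩ ?_ ?_ ?_
  · rintro s t hst ⟨m, hm, M, H⟩
    exact ⟨m, hm, M, fun c hc => H c (hst hc)⟩
  · rintro s t ⟨m, hm, M, H⟩ ⟨m', hm', M', H'⟩
    refine ⟨min m m', lt_min hm hm', max M M', ?_⟩
    rintro c (hc | hc)
    · exact (H c hc).mono (sub_le_sub_right (min_le_left _ _) _)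
        (sub_le_sub_right (le_max_left _ _) _)
    · exact (H' c hc).mono (sub_le_sub_right (min_le_right _ _) _)
        (sub_le_sub_right (le_max_right _ _) _)
  · intro c₀ _
    obtain ⟨K, hK, J, hJ, H⟩ := exists_fiber_bound_of_reparametrization hp hL hu1 hA c₀
    have hK2 : 0 < K ^ 2 := by positivity
    have hlow : RectGE (u ∘ cover) (1 / K ^ 2 - 1) J :=
      RectGE.of_partialFst hu1 fun t c hc c' hc' hcc => by
        have := ((H c hc c' hc' hcc).2 (t : UnitAddCircle)).2
        rw [← dTheta_cover hu1, ← dTheta_cover hu1, sub_mul, one_div_mul_eq_div, sub_le_iff_le_add,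
          div_le_iff₀' hK2]
        refine this.trans_eq ?_
        simp only [cover]
        ring
    have hupp : RectGE (-(u ∘ cover)) (1 - K ^ 2) J :=
      RectGE.of_partialFst hu1.neg fun t c hc c' hc' hcc => by
        have := ((H c hc c' hc' hcc).2 (t : UnitAddCircle)).1
        rw [partialFst_neg, partialFst_neg, ← dTheta_cover hu1, ← dTheta_cover hu1]
        simp only [cover]
        linarith
    refine ⟨interior J, mem_nhdsWithin_of_mem_nhds (interior_mem_nhds.2 hJ), 1 / K ^ 2,
      by positivity, K ^ 2, fun c hc t₁ t₂ ht => ?_⟩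
    have hJc : J ∈ 𝓝 c := mem_interior_iff_mem_nhds.1 hc
    refine ⟨hlow.partialSnd hu1 hJc ht, ?_⟩
    have := hupp.partialSnd hu1.neg hJc ht
    rw [partialSnd_neg, partialSnd_neg] at this
    linarith

theorem HasUniformSlopes.exists_lipschitzWith_dC (h : HasUniformSlopes u) (hu1 : IsCn 1 u)
    {C : Set ℝ} (hC : IsCompact C) :
    ∃ L : ℝ≥0, ∀ c ∈ C, LipschitzWith L fun θ : UnitAddCircle => dC u (θ, c) := by
  obtain ⟨m, hm, M, H⟩ := h C hC
  refine ⟨(max |m - 1| |M - 1|).toNNReal, fun c hc => LipschitzWith.of_dist_le_mul fun θ θ' => ?_⟩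
  obtain ⟨x, y, rfl, rfl, hxy⟩ := exists_lift_dist θ θ'
  rw [← hxy, Real.coe_toNNReal _ (le_max_of_le_left (abs_nonneg _))]
  have := (H c hc).abs_sub_le x y
  rw [← dC_cover hu1, ← dC_cover hu1] at this
  exact this

/-! ### Almost everywhere statements on the annulus, its circles and the line -/

theorem ae_annulus_iff_of_measurableSet {s : Set Annulus} (hs : MeasurableSet s) :
    (∀ᵐ p, p ∈ s) ↔ ∀ᵐ c : ℝ, ∀ᵐ θ : UnitAddCircle, (θ, c) ∈ s := by
  have e : (volume : Measure Annulus) =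
      ((volume : Measure ℝ).prod (volume : Measure UnitAddCircle)).map Prod.swap := by
    rw [Measure.prod_swap]
    rfl
  rw [e]
  exact (ae_map_iff (p := (· ∈ s)) measurable_swap.aemeasurable hs).trans <|
    Measure.ae_prod_mem_iff_ae_ae_mem (measurable_swap hs)

/-- This direction of Fubini needs no measurability, so it applies to the existence of a mixed
derivative within given bounds. -/
theorem ae_ae_of_ae_annulus {P : Annulus → Prop} (h : ∀ᵐ p, P p) :
    ∀ᵐ c : ℝ, ∀ᵐ θ : UnitAddCircle, P (θ, c) := by
  have e : (volume : Measure Annulus) =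
      ((volume : Measure ℝ).prod (volume : Measure UnitAddCircle)).map Prod.swap := by
    rw [Measure.prod_swap]
    rfl
  rw [e] at h
  exact Measure.ae_ae_of_ae_prod (ae_of_ae_map measurable_swap.aemeasurable h)

theorem ae_coe_of_ae {P : UnitAddCircle → Prop} (h : ∀ᵐ θ, P θ) :
    ∀ᵐ t : ℝ, P (t : UnitAddCircle) := by
  have h1 : ∀ n : ℤ, ∀ᵐ t : ℝ ∂(volume.restrict (Set.Ioc (n : ℝ) (n + 1))), P (t : UnitAddCircle) :=
    fun n => (UnitAddCircle.measurePreserving_mk n).quasiMeasurePreserving.ae h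
  rw [← Measure.restrict_univ (μ := (volume : Measure ℝ)), ← iUnion_Ioc_intCast ℝ,
    ae_restrict_iUnion_iff]
  exact h1

theorem ae_of_ae_coe {s : Set UnitAddCircle} (hs : MeasurableSet s)
    (h : ∀ᵐ t : ℝ, (t : UnitAddCircle) ∈ s) : ∀ᵐ θ, θ ∈ s := by
  have hm := UnitAddCircle.measurePreserving_mk 0
  rw [← hm.map_eq]
  exact (ae_map_iff hm.measurable.aemeasurable hs).2 (ae_restrict_of_ae h)

/-- Rademacher on each circle, then Fubini; the latter needs the differentiability set to be
measurable, which continuity of ∂u/∂c ensures. -/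
theorem HasUniformSlopes.ae_differentiableAt (h : HasUniformSlopes u) (hu1 : IsCn 1 u) :
    ∀ᵐ p : Annulus, ∃ d, HasMixedDerivAt u d p := by
  set s : Set Annulus :=
    {p | DifferentiableAt ℝ (fun t : ℝ => dC u (p.1 + (t : UnitAddCircle), p.2)) 0} with hs_def
  have hs : MeasurableSet s := by
    have hc : Continuous (Function.uncurry fun (p : Annulus) (t : ℝ) =>
        dC u (p.1 + (t : UnitAddCircle), p.2)) := by
      refine (continuous_dC hu1).comp ?_
      have := AddCircle.continuous_mk' (1 : ℝ)
      exact ((continuous_fst.comp continuous_fst).add (this.comp continuous_snd)).prodMk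
        (continuous_snd.comp continuous_fst)
    exact (measurableSet_of_differentiableAt_with_param ℝ hc).preimage
      (measurable_id.prodMk measurable_const)
  have key : ∀ᵐ p, p ∈ s := by
    refine (ae_annulus_iff_of_measurableSet hs).2 (Eventually.of_forall fun c => ?_)
    refine ae_of_ae_coe (s := {θ | (θ, c) ∈ s}) (hs.preimage (measurable_id.prodMk measurable_const))
      ?_
    obtain ⟨m, hm, M, H⟩ := h {c} isCompact_singleton
    filter_upwards [(H c rfl).lipschitzWith.ae_differentiableAt_real] with t ht
    exact ((hasMixedDerivAt_cover hu1 _ (t, c)).2 ht.hasDerivAt).differentiableAt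
  filter_upwards [key] with p hp using ⟨_, hp.hasDerivAt⟩

theorem HasUniformSlopes.ae_mixed_bound (h : HasUniformSlopes u) (hu1 : IsCn 1 u)
    {K : Set Annulus} (hK : IsCompact K) :
    ∃ kminus kplus : ℝ, -1 < kminus ∧ kminus < kplus ∧ ∀ᵐ p : Annulus ∂(volume.restrict K),
      ∃ d : ℝ, HasMixedDerivAt u d p ∧ kminus ≤ d ∧ d ≤ kplus := by
  obtain ⟨m, hm, M, H⟩ := h (Prod.snd '' K) (hK.image continuous_snd)
  -- The maximum with m only serves to make the two constants strictly ordered.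
  refine ⟨m - 1, max (M - 1) m, by linarith, lt_max_of_lt_right (by linarith), ?_⟩
  rw [ae_restrict_iff' hK.measurableSet]
  filter_upwards [h.ae_differentiableAt hu1] with p hd hp
  obtain ⟨d, hd⟩ := hd
  obtain ⟨z, rfl⟩ := surjective_cover p
  obtain ⟨h1, h2⟩ := (H z.2 ⟨_, hp, rfl⟩).hasDerivAt_mem ((hasMixedDerivAt_cover hu1 d z).1 hd)
  exact ⟨d, hd, h1, le_max_of_le_left h2⟩

/-- Almost everywhere lower bounds on the mixed derivative are lower bounds on slopes. -/
theorem exists_slope_ge_of_ae_mixed_bound (hu1 : IsCn 1 u)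
    (hLip : ∀ C : Set ℝ, IsCompact C → ∃ L : ℝ≥0, ∀ c ∈ C,
      LipschitzWith L fun θ : UnitAddCircle => dC u (θ, c))
    (hmix : ∀ K : Set Annulus, IsCompact K → ∃ kminus kplus : ℝ, -1 < kminus ∧ kminus < kplus ∧
      ∀ᵐ p : Annulus ∂(volume.restrict K),
        ∃ d : ℝ, HasMixedDerivAt u d p ∧ kminus ≤ d ∧ d ≤ kplus) (R : ℝ) :
    ∃ m > 0, ∀ c, |c| < R → ∀ t₁ t₂, t₁ ≤ t₂ →
      (m - 1) * (t₂ - t₁) ≤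
        partialSnd (u ∘ cover) (t₂, c) - partialSnd (u ∘ cover) (t₁, c) := by
  have hK : IsCompact ((Set.univ : Set UnitAddCircle) ×ˢ Set.Icc (-R) R) :=
    isCompact_univ.prod isCompact_Icc
  obtain ⟨k, k', hk, -, H⟩ := hmix _ hK
  rw [ae_restrict_iff' hK.measurableSet] at H
  refine ⟨k + 1, by linarith, ?_⟩
  rw [add_sub_cancel_right]
  have hae : ∀ᵐ c : ℝ, c ∈ Set.Icc (-R) R → ∀ t₁ t₂, t₁ ≤ t₂ → k * (t₂ - t₁) ≤
      partialSnd (u ∘ cover) (t₂, c) - partialSnd (u ∘ cover) (t₁, c) := by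
    filter_upwards [ae_ae_of_ae_annulus H] with c hc hcR t₁ t₂ ht
    obtain ⟨L, hL⟩ := hLip {c} isCompact_singleton
    have hLg : LipschitzWith L fun t => partialSnd (u ∘ cover) (t, c) :=
      LipschitzWith.of_dist_le_mul fun x y => by
        have := (hL c rfl).dist_le_mul (x : UnitAddCircle) y
        refine (this.trans (mul_le_mul_of_nonneg_left (dist_coe_le x y) L.2)).trans_eq' ?_
        rw [← dC_cover hu1, ← dC_cover hu1]
        rfl
    refine hLg.mul_sub_le_of_ae_le_deriv ?_ ht
    filter_upwards [ae_coe_of_ae hc] with t htc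
    obtain ⟨d, hd, hkd, -⟩ := htc ⟨trivial, hcR⟩
    have hd' := (hasMixedDerivAt_cover hu1 d (t, c)).1 hd
    rw [hd'.deriv]
    exact hkd
  intro c hc t₁ t₂ ht
  -- The bound is known for almost every height. By continuity of ∂₂V, a failure at c would persist
  -- on an open set of heights, which meets the dense set of good ones.
  by_contra! hlt
  have hcont := continuous_partialSnd hu1
  have hopen : IsOpen ({c | partialSnd (u ∘ cover) (t₂, c) - partialSnd (u ∘ cover) (t₁, c) <
      k * (t₂ - t₁)} ∩ {c | |c| < R}) :=
    (isOpen_lt (by fun_prop) continuous_const).inter (isOpen_lt continuous_abs continuous_const)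
  obtain ⟨c', hc', hc'2⟩ := (Measure.dense_of_ae hae).inter_open_nonempty _ hopen ⟨c, hlt, hc⟩
  exact (hc'2 (abs_le.1 hc'.2.le) t₁ t₂ ht).not_gt hc'.1

/-- Lower bounds on the slopes of `θ ↦ θ + ∂u/∂c(θ, c)` make `u` a generating function of a
homeomorphism. -/
theorem isTwist_of_slope_ge (h : Parametrizes (fun c θ => c + dTheta u (θ, c)) Ψ 𝓕)
    (hu1 : IsCn 1 u)
    (hs : ∀ R : ℝ, ∃ m > 0, ∀ c, |c| < R → ∀ t₁ t₂, t₁ ≤ t₂ → (m - 1) * (t₂ - t₁) ≤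
      partialSnd (u ∘ cover) (t₂, c) - partialSnd (u ∘ cover) (t₁, c)) :
    IsTwist (u ∘ cover) where
  contDiff := hu1
  periodic := isPeriodic_comp_cover u
  rectGE R := by
    obtain ⟨m, hm, H⟩ := hs (R + 1)
    exact ⟨m, hm, RectGE.of_partialSnd hu1 (convex_Icc _ _) fun c hc =>
      H c ((abs_le.2 hc).trans_lt (lt_add_one R))⟩
  surjective t r := by
    obtain ⟨c, hc⟩ := h.surjective (t : UnitAddCircle) r
    refine ⟨c, ?_⟩
    simp only [← dTheta_cover hu1]
    exact hc

theorem locallyBiLipschitz_of_isTwist (h : Parametrizes (fun c θ => c + dTheta u (θ, c)) Ψ 𝓕)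
    (hu1 : IsCn 1 u) (hV : IsTwist (u ∘ cover)) (hL : LocallyLipschitz (dTheta u)) :
    LocallyBiLipschitz Ψ := by
  rintro ⟨θ₀, c₀⟩
  obtain ⟨K, W, hW, hK⟩ := hL (θ₀, c₀)
  rw [nhds_prod_eq, mem_prod_iff] at hW
  obtain ⟨S, hS, J, hJ, hSJ⟩ := hW
  obtain ⟨m, hm, hmon⟩ := hV.le_partialFst (|c₀| + 1)
  have hfib : ∀ θ c c', |c| ≤ |c₀| + 1 → |c'| ≤ |c₀| + 1 →
      m * |c - c'| ≤ |c + dTheta u (θ, c) - (c' + dTheta u (θ, c'))| := by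
    intro θ c c' hc hc'
    wlog hcc : c' ≤ c generalizing c c'
    · rw [abs_sub_comm, abs_sub_comm (c + _)]
      exact this c' c hc' hc (le_of_not_ge hcc)
    obtain ⟨t, rfl⟩ := QuotientAddGroup.mk_surjective θ
    have := hmon t c' c hc' hc hcc
    rw [← dTheta_cover hu1, ← dTheta_cover hu1] at this
    rw [abs_of_nonneg (sub_nonneg.2 hcc)]
    exact this.trans (le_abs_self _)
  have hK0 : (0 : ℝ) ≤ K := K.2
  -- 1 + K controls Ψ and (1 + K) / m its inverse: moving (θ', c') to (θ, c') changes ∂u/∂θ by at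
  -- most K dist θ θ', and `hfib` then compares heights on one fibre.
  set B : ℝ := 1 + K + (1 + K) / m with hB
  have hq : 0 ≤ (1 + K) / m := by positivity
  have hJ' : {c : ℝ | |c| < |c₀| + 1} ∈ 𝓝 c₀ :=
    (isOpen_lt continuous_abs continuous_const).mem_nhds (lt_add_one |c₀|)
  refine ⟨B.toNNReal, S ×ˢ (J ∩ {c : ℝ | |c| < |c₀| + 1}),
    prod_mem_nhds hS (inter_mem hJ hJ'), ?_⟩
  rintro ⟨θ, c⟩ ⟨hθ, hc, hcR⟩ ⟨θ', c'⟩ ⟨hθ', hc', hcR'⟩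
  rw [Real.coe_toNNReal _ (by positivity), h.1, h.1]
  simp only
  have hd1 := hK.dist_le_mul (θ, c) (hSJ ⟨hθ, hc⟩) (θ', c') (hSJ ⟨hθ', hc'⟩)
  have hd2 := hK.dist_le_mul (θ, c') (hSJ ⟨hθ, hc'⟩) (θ', c') (hSJ ⟨hθ', hc'⟩)
  have hf := hfib θ c c' hcR.le hcR'.le
  have e2 : dist ((θ, c') : Annulus) (θ', c') = dist θ θ' := by
    rw [Prod.dist_eq, dist_self, max_eq_left dist_nonneg]
  rw [e2, Real.dist_eq] at hd2
  rw [Real.dist_eq] at hd1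
  constructor
  · set D := dist ((θ, c) : Annulus) (θ', c') with hD
    have hD0 : 0 ≤ D := dist_nonneg
    have hDθ : dist θ θ' ≤ D := le_max_left _ _
    have hDc : |c - c'| ≤ D := le_max_right _ _
    have hBD : (1 + K) * D ≤ B * D := mul_le_mul_of_nonneg_right (by linarith) hD0
    refine max_le ?_ ?_
    · have := mul_nonneg hK0 hD0
      simp only
      linarith
    · simp only [Real.dist_eq]
      have := abs_add_le (c - c') (dTheta u (θ, c) - dTheta u (θ', c'))
      rw [show c + dTheta u (θ, c) - (c' + dTheta u (θ', c')) =
        c - c' + (dTheta u (θ, c) - dTheta u (θ', c')) by ring]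
      linarith
  · set D := dist ((θ, c + dTheta u (θ, c)) : Annulus) (θ', c' + dTheta u (θ', c')) with hD
    have hD0 : 0 ≤ D := dist_nonneg
    have hDθ : dist θ θ' ≤ D := le_max_left _ _
    have hDc : |c + dTheta u (θ, c) - (c' + dTheta u (θ', c'))| ≤ D := le_max_right _ _
    have hKD : (K : ℝ) * dist θ θ' ≤ K * D := mul_le_mul_of_nonneg_left hDθ hK0
    refine max_le ?_ ?_
    · have : 1 * D ≤ B * D := mul_le_mul_of_nonneg_right (by linarith) hD0
      simp only
      linarith
    · have h1 : m * |c - c'| ≤ (1 + K) * D := by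
        have := abs_add_le (c + dTheta u (θ, c) - (c' + dTheta u (θ', c')))
          (dTheta u (θ', c') - dTheta u (θ, c'))
        rw [abs_sub_comm (dTheta u (θ', c'))] at this
        rw [show c + dTheta u (θ, c) - (c' + dTheta u (θ', c')) +
          (dTheta u (θ', c') - dTheta u (θ, c')) =
          c + dTheta u (θ, c) - (c' + dTheta u (θ, c')) by ring] at this
        linarith
      have h2 : |c - c'| ≤ (1 + K) / m * D := by
        rw [div_mul_eq_mul_div, le_div_iff₀ hm]
        linarith
      have h3 : (1 + K) / m * D ≤ B * D := mul_le_mul_of_nonneg_right (by linarith) hD0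
      exact h2.trans h3

/-- The identity Φ ∘ G = H gives one implication; for the other, surjectivity of t ↦ t + ∂₂V(t, c)
puts every point in the image of G. -/
theorem generates_homeo (hu1 : IsCn 1 u) (hV : IsTwist (u ∘ cover)) : Generates u hV.homeo := by
  have key : ∀ (θ : UnitAddCircle) (c : ℝ),
      hV.homeo (θ + (dC u (θ, c) : UnitAddCircle), c) = (θ, c + dTheta u (θ, c)) := by
    intro θ c
    obtain ⟨t, rfl⟩ := QuotientAddGroup.mk_surjective θ
    have := hV.homeo_cover_homeoFst (t, c)
    rw [hV.homeoFst_apply, hV.homeoSnd_apply, ← dC_cover hu1, ← dTheta_cover hu1] at this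
    exact this
  intro x θ c r
  constructor
  · intro hΦ
    obtain ⟨x, rfl⟩ := QuotientAddGroup.mk_surjective x
    obtain ⟨t, ht⟩ := hV.surjective_fst c x
    have hx : ((x : ℝ) : UnitAddCircle) = (t : UnitAddCircle) +
        (dC u ((t : UnitAddCircle), c) : UnitAddCircle) := by
      simp only [← dC_cover hu1] at ht
      rw [← ht]
      rfl
    change hV.homeo ((x : UnitAddCircle), c) = _ at hΦ
    rw [hx, key, Prod.ext_iff] at hΦ
    obtain ⟨rfl, rfl⟩ := hΦ
    exact ⟨hx, rfl⟩
  · rintro ⟨rfl, rfl⟩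
    exact key θ c

theorem Generates.mapsStandardFoliationOnto {Φ : Annulus ≃ₜ Annulus} (hΦ : Generates u Φ)
    (h : Parametrizes (fun c θ => c + dTheta u (θ, c)) Ψ 𝓕) : MapsStandardFoliationOnto Φ 𝓕 := by
  rw [MapsStandardFoliationOnto, h.2]
  congr 1
  funext c
  ext ⟨θ, r⟩
  constructor
  · rintro ⟨⟨x, c'⟩, rfl, hx⟩
    exact ((hΦ x θ _ r).1 hx).2
  · intro hr
    exact ⟨(θ + (dC u (θ, c) : UnitAddCircle), c), rfl, (hΦ _ θ c r).2 ⟨rfl, hr⟩⟩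

theorem HasUniformSlopes.isTwist (hs : HasUniformSlopes u)
    (h : Parametrizes (fun c θ => c + dTheta u (θ, c)) Ψ 𝓕) (hu1 : IsCn 1 u) :
    IsTwist (u ∘ cover) :=
  isTwist_of_slope_ge h hu1 fun R => by
    obtain ⟨m, hm, M, H⟩ := hs (Set.Icc (-R) R) isCompact_Icc
    exact ⟨m, hm, fun c hc t₁ t₂ ht => (H c (abs_le.1 hc.le) t₁ t₂ ht).1⟩

end Foliation

end Annulus

theorem proposition4 (𝓕 : Set (Set Annulus)) (h𝓕 : Annulus.IsGraphFoliation 𝓕)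
    (u : Annulus → ℝ) (hu : Annulus.IsFoliationGeneratingFunction u 𝓕)
    (hu1 : Annulus.IsCn 1 u) :
    (Annulus.IsLipschitzFoliation 𝓕 ↔
      LocallyLipschitz (Annulus.dTheta u) ∧
      (∀ C : Set ℝ, IsCompact C → ∃ L : ℝ≥0, ∀ c ∈ C,
        LipschitzWith L fun θ : UnitAddCircle => Annulus.dC u (θ, c)) ∧
      (∀ K : Set Annulus, IsCompact K → ∃ kminus kplus : ℝ, -1 < kminus ∧ kminus < kplus ∧
        ∀ᵐ p : Annulus ∂(volume.restrict K),
          ∃ d : ℝ, Annulus.HasMixedDerivAt u d p ∧ kminus ≤ d ∧ d ≤ kplus)) ∧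
    (Annulus.IsLipschitzFoliation 𝓕 →
      ∃ Φ : Annulus ≃ₜ Annulus, Annulus.IsExactSymplecticHomeo Φ ∧
        Annulus.Generates u Φ ∧ Annulus.MapsStandardFoliationOnto Φ 𝓕) := by

  obtain ⟨η, Ψ, hp⟩ := h𝓕
  obtain ⟨A, hA⟩ := hp.exists_reparametrization hu hu1
  refine ⟨⟨fun h => ?_, fun ⟨hL, hLip, hmix⟩ => ?_⟩, fun h => ?_⟩
  · have hs := h.hasUniformSlopes hu hu1
    -- The parametrization used here must be the biLipschitz one, not the arbitrary one from `h𝓕`.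
    obtain ⟨η', Ψ', hp', hL'⟩ := h
    obtain ⟨A', hA'⟩ := hp'.exists_reparametrization hu hu1
    exact ⟨Annulus.locallyLipschitz_dTheta hp' hL' hu1 hA',
      fun C hC => hs.exists_lipschitzWith_dC hu1 hC, fun K hK => hs.ae_mixed_bound hu1 hK⟩
  · exact ⟨_, _, hA, Annulus.locallyBiLipschitz_of_isTwist hA hu1
      (Annulus.isTwist_of_slope_ge hA hu1
        (Annulus.exists_slope_ge_of_ae_mixed_bound hu1 hLip hmix)) hL⟩
  · have hV := (h.hasUniformSlopes hu hu1).isTwist hA hu1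
    have hg := Annulus.generates_homeo hu1 hV
    exact ⟨hV.homeo, hV.isExactSymplecticHomeo_homeo, hg, hg.mapsStandardFoliationOnto hA⟩
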